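/- Let $S$ be a finite set of primes, $\mathbb{Q}_S=\prod_{p\in S}\mathbb{Q}_p$, $\mathbb{Z}_S=\prod_{p\in S}\mathbb{Z}_p$, and let $dx$ be the Haar measure on $\mathbb{Q}_S$ with $\int_{\mathbb{Z}_S}dx=1$. Let $\chi(x)=\prod_{p\in S}e^{2\pi i\{x_p\}_p}$ be the canonical additive character, where $\{\cdot\}_p$ is the $p$-adic fractional part, and let $\mathcal F f=\widehat f$ be the Fourier transform on $L^2(\mathbb{Q}_S)$, i.e. the continuous extension of $\widehat\varphi(\xi)=\int_{\mathbb{Q}_S}\varphi(x)\chi(\xi x)\,dx$ from the locally constant functions $\varphi$ of compact support. For $n\ge 0$ put $e^{\psi(n)}=\operatorname{lcm}\{p^l\le n : p\in S,\ l\ge 0\}$ (so $\psi(0)=0$), and $\psi(-n)=-\psi(n)$. For $0\ne x\in\mathbb{Q}_S$ let $\operatorname{ord}(x)=\max\{n\in\mathbb{Z}: x\in e^{\psi(n)}\mathbb{Z}_S\}$ and $\|x\|=e^{-\psi(\operatorname{ord}(x))}$; put $\|0\|=0$. Let $\alpha>0$ and let $D^\alpha$ be the unbounded operator on $L^2(\mathbb{Q}_S)$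 given by $$\widehat{D^\alpha f}(\xi)=\|\xi\|^\alpha\widehat f(\xi),\qquad \operatorname{Dom}(D^\alpha)=\{f\in L^2(\mathbb{Q}_S): \|\xi\|^\alpha\widehat f\in L^2(\mathbb{Q}_S)\}.$$ For $t>0$ let $Z(x,t)=\int_{\mathbb{Q}_S}\chi(-x\xi)\,e^{-t\|\xi\|^\alpha}\,d\xi$; this integral converges absolutely. Theorem. For every $t>0$ and $f\in L^2(\mathbb{Q}_S)$ the convolution $$\mathbf T(t)f(x)=\int_{\mathbb{Q}_S}Z(y,t)f(x-y)\,dy$$ converges absolutely for every $x$ and defines a bounded operator $\mathbf T(t)$ on $L^2(\mathbb{Q}_S)$. With $\mathbf T(0)=\mathrm{id}$, the family $(\mathbf T(t))_{t\ge 0}$ is a $C_0$-semigroup whose infinitesimal generator is $-D^\alpha$ (with domain $\operatorname{Dom}(D^\alpha)$), and every $C_0$-semigroup $(\mathbf S(t))_{t\ge0}$ on $L^2(\mathbb{Q}_S)$ with generator $-D^\alpha$ satisfies $\mathbf S(t)=\mathbf T(t)$ for all $t\ge 0$. Moreover, for every $f\in\operatorname{Dom}(D^\alpha)$, $u(\cdot,t)=\mathbf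 T(t)f$ is the unique classical solution of $$u_t+D^\alpha u=0\quad(t>0),\qquad u(\cdot,0)=f,$$ that is, the unique continuously differentiable $u:[0,\infty)\to L^2(\mathbb{Q}_S)$ with $u(t)\in\operatorname{Dom}(D^\alpha)$ for all $t\ge0$, $u'(t)=-D^\alpha u(t)$ for all $t>0$, and $u(0)=f$. -/

import Mathlib

open MeasureTheory Filter Topology
open scoped NNReal ENNReal Convolution

noncomputable section

namespace SAdic

/-! ### The ring `ℚ_S` and its Haar measure -/

instance primesFact (p : Nat.Primes) : Fact (p : ℕ).Prime := ⟨p.2⟩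

instance padicMeasurableSpace (p : ℕ) [Fact p.Prime] : MeasurableSpace ℚ_[p] := borel ℚ_[p]

instance padicBorelSpace (p : ℕ) [Fact p.Prime] : BorelSpace ℚ_[p] := ⟨rfl⟩

/-- The direct product `ℚ_S = ∏_{p ∈ S} ℚ_p`, with the product topology. -/
abbrev QS (S : Finset Nat.Primes) : Type := (p : S) → ℚ_[((p : Nat.Primes) : ℕ)]

/-- The compact open subgroup `ℤ_p` of `ℚ_p`. -/
def padicUnitBall (p : ℕ) [Fact p.Prime] : TopologicalSpace.PositiveCompacts ℚ_[p] where
  carrier := Metric.closedBall 0 1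
  isCompact' := isCompact_closedBall 0 1
  interior_nonempty' := ⟨0, interior_mono Metric.ball_subset_closedBall
    (by rw [Metric.isOpen_ball.interior_eq]; exact Metric.mem_ball_self one_pos)⟩

/-- The Haar measure of `ℚ_S` giving mass one to `ℤ_S = ∏ ℤ_p`: the product of the Haar
measures of the `ℚ_p` that give mass one to `ℤ_p`. -/
def haar (S : Finset Nat.Primes) : Measure (QS S) :=
  Measure.pi fun p : S => Measure.addHaarMeasure (padicUnitBall ((p : Nat.Primes) : ℕ))

/-! ### The canonical character -/

/-- Multiplying `x ∈ ℚ_p` by `p ^ n`, where `n = max (-ord_p x) 0`, gives a `p`-adic integer. -/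
theorem norm_mul_pow_le_one {p : ℕ} [Fact p.Prime] (x : ℚ_[p]) :
    ‖x * (p : ℚ_[p]) ^ (-x.valuation).toNat‖ ≤ 1 := by
  by_cases hx : x = 0
  · simp [hx]
  · have hp : (1 : ℝ) < p := by exact_mod_cast (Fact.out : p.Prime).one_lt
    have hp0 : (p : ℝ) ≠ 0 := by positivity
    rw [norm_mul, Padic.norm_eq_zpow_neg_valuation hx, norm_pow, Padic.norm_p, inv_pow,
      ← zpow_natCast, ← zpow_neg, ← zpow_add₀ hp0]
    apply zpow_le_one_of_nonpos₀ hp.le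
    have := Int.self_le_toNat (-x.valuation)
    omega

/-- The fractional part `{x}_p`. With `n = max (-ord_p x) 0` the `p`-adic integer `p ^ n x` has an
expansion `∑ a_i p ^ i`, `0 ≤ a_i < p`; its truncation `∑_{i < n} a_i p ^ i` is `appr n`, and
`{x}_p` is `p ^ (-n)` times that truncation. -/
def fracPart {p : ℕ} [Fact p.Prime] (x : ℚ_[p]) : ℝ :=
  (PadicInt.appr (⟨x * (p : ℚ_[p]) ^ (-x.valuation).toNat, norm_mul_pow_le_one x⟩ : ℤ_[p])
    (-x.valuation).toNat : ℝ) / (p : ℝ) ^ (-x.valuation).toNat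

/-- The canonical additive character `χ(x) = ∏_{p ∈ S} exp (2 π i {x_p}_p)` of `ℚ_S`. -/
def chi {S : Finset Nat.Primes} (x : QS S) : ℂ :=
  ∏ p : S, Complex.exp (2 * Real.pi * Complex.I * (fracPart (x p) : ℝ))

/-! ### The ultrametric of the Chebyshev function -/

open Classical in
/-- For `n : ℕ`, the number `e ^ ψ(n) = lcm {p ^ l ≤ n : p ∈ S, l ≥ 0}`
(equal to `1` for `n = 0`). -/
def chebLcm (S : Finset Nat.Primes) (n : ℕ) : ℕ :=
  ((Finset.Icc 1 n).filter fun m => ∃ p ∈ S, ∃ l : ℕ, m = (p : ℕ) ^ l).lcm id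

/-- For `n : ℤ`, the number `e ^ ψ(n)`, where `ψ(n) = sign(n) ψ(|n|)`. -/
def expPsi (S : Finset Nat.Primes) (n : ℤ) : ℚ := (chebLcm S n.natAbs : ℚ) ^ n.sign

/-- The subgroup `e ^ ψ(n) ℤ_S` of `ℚ_S`. -/
def filt (S : Finset Nat.Primes) (n : ℤ) : Set (QS S) :=
  {x | ∃ z : QS S, (∀ p : S, ‖z p‖ ≤ 1) ∧
    x = fun p : S => (expPsi S n : ℚ_[((p : Nat.Primes) : ℕ)]) * z p}

/-- The order of `x ≠ 0`: the largest `n` with `x ∈ e ^ ψ(n) ℤ_S`. -/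
def order {S : Finset Nat.Primes} (x : QS S) : ℤ := sSup {n : ℤ | x ∈ filt S n}

open Classical in
/-- The norm `‖x‖ = e ^ (-ψ(ord x))`, `‖0‖ = 0`, of the ultrametric `d(x, y) = ‖x - y‖`.
(It is not the sup norm of the product.) -/
def normS {S : Finset Nat.Primes} (x : QS S) : ℝ :=
  if x = 0 then 0 else ((expPsi S (order x) : ℚ) : ℝ)⁻¹

/-! ### The Fourier transform and the operator `D ^ α` -/

/-- The Hilbert space `L²(ℚ_S)`. -/
abbrev L2 (S : Finset Nat.Primes) : Type := Lp ℂ 2 (haar S)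

/-- The Fourier transform `φ̂(ξ) = ∫ φ(x) χ(ξ x) dx`. -/
def fourierIntegral {S : Finset Nat.Primes} (φ : QS S → ℂ) (ξ : QS S) : ℂ :=
  ∫ x, φ x * chi (ξ * x) ∂(haar S)

/-- `HasFourier f g`: `g` is the image of `f` under the Fourier transform of `L²(ℚ_S)`, which
is the continuous extension of the Fourier transform of test functions (locally constant
functions of compact support): `(f, g)` is a limit in `L² × L²` of pairs `(φ, φ̂)`. -/
def HasFourier {S : Finset Nat.Primes} (f g : L2 S) : Prop :=
  (f, g) ∈ closure {q : L2 S × L2 S | ∃ φ : QS S → ℂ, IsLocallyConstant φ ∧ HasCompactSupport φ ∧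
    q.1 =ᵐ[haar S] φ ∧ q.2 =ᵐ[haar S] fourierIntegral φ}

/-- The domain of `D ^ α`: all `f ∈ L²` with `‖ξ‖ ^ α f̂(ξ) ∈ L²`. -/
def domD (S : Finset Nat.Primes) (α : ℝ) : Set (L2 S) :=
  {f | ∃ fhat : L2 S, HasFourier f fhat ∧
    MemLp (fun ξ => ((normS ξ ^ α : ℝ) : ℂ) * fhat ξ) 2 (haar S)}

/-- The graph of the unbounded operator `D ^ α`: `D ^ α f = g` means that
`ĝ(ξ) = ‖ξ‖ ^ α f̂(ξ)`. -/
def IsD {S : Finset Nat.Primes} (α : ℝ) (f g : L2 S) : Prop :=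
  ∃ fhat ghat : L2 S, HasFourier f fhat ∧ HasFourier g ghat ∧
    ghat =ᵐ[haar S] fun ξ => ((normS ξ ^ α : ℝ) : ℂ) * fhat ξ

/-! ### Semigroups, classical solutions, heat kernel -/

/-- A `C₀`-semigroup of bounded operators on a complex Banach space. -/
structure IsC0Semigroup {E : Type*} [NormedAddCommGroup E] [NormedSpace ℂ E]
    (T : ℝ≥0 → E →L[ℂ] E) : Prop where
  zero : T 0 = ContinuousLinearMap.id ℂ E
  add : ∀ s t, T (s + t) = (T s).comp (T t)
  continuous : ∀ f, Continuous fun t => T t f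

/-- The graph of the infinitesimal generator `A` of a semigroup: `A f = g` means that
`(T h f - f) / h → g` as `h → 0+`. -/
def IsGenerator {E : Type*} [NormedAddCommGroup E] [NormedSpace ℂ E]
    (T : ℝ≥0 → E →L[ℂ] E) (f g : E) : Prop :=
  Tendsto (fun h : ℝ≥0 => (((h : ℝ)⁻¹ : ℝ) : ℂ) • (T h f - f)) (𝓝[>] 0) (𝓝 g)

/-- `T` is a `C₀`-semigroup on `L²(ℚ_S)` whose generator is exactly `-D ^ α` (same domain, same
values). -/
def IsC0SemigroupGeneratedByNegD {S : Finset Nat.Primes} (α : ℝ)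
    (T : ℝ≥0 → L2 S →L[ℂ] L2 S) : Prop :=
  IsC0Semigroup T ∧ ∀ f g : L2 S, IsGenerator T f g ↔ IsD α f (-g)

/-- Classical solutions `u : [0, ∞) → L²` of `u_t + D ^ α u = 0` (`t > 0`), `u(0) = f`. Values
of `u` at negative times play no role. -/
structure IsClassicalSolution {S : Finset Nat.Primes} (α : ℝ) (f : L2 S) (u : ℝ → L2 S) :
    Prop where
  contDiff : ContDiffOn ℝ 1 u (Set.Ici 0)
  mem_dom : ∀ t, 0 ≤ t → u t ∈ domD S α
  equation : ∀ t, 0 < t → ∃ g : L2 S, IsD α (u t) g ∧ HasDerivAt u (-g) t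
  initial : u 0 = f

/-- The heat kernel `Z(x, t) = ∫ χ(-x ξ) exp (-t ‖ξ‖ ^ α) dξ`. -/
def heatKernel {S : Finset Nat.Primes} (α t : ℝ) (x : QS S) : ℂ :=
  ∫ ξ, chi (-(x * ξ)) * ((Real.exp (-t * normS ξ ^ α) : ℝ) : ℂ) ∂(haar S)

end SAdic

end

noncomputable section

namespace SAdic

/-! ### The local characters -/

section Local

variable {p : ℕ} [Fact p.Prime]

/-! The Fourier transform turns `D ^ α` into multiplication by `m(ξ) = ‖ξ‖ ^ α ≥ 0`, so the
semigroup is `F⁻¹ exp(-t m) F` (`heatOp`). For the multiplication semigroup, strong continuity, the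
generator `-m` on its maximal domain and the derivative of orbits follow from convergence in `L²`.
The bound `|exp(-s m) - exp(-t m)| ≤ |s - t| m` supplies the majorant for difference quotients
(`hasDerivWithinAt_expOp`, `isGenerator_expOp_iff`). Both uniqueness claims rest on dissipativity:
as `m ≥ 0`, the norm of the difference of two solutions cannot grow (`eq_zero_of_dissipative`). For
semigroups this gives equality on the domain, and density of the domain does the rest.

The unitary `fourierL2` comes from the filtration `e ^ ψ(n) ℤ_S`. Its members are compact open
subgroups, shrink to zero and exhaust `ℚ_S`; the annihilator of the member of index `n` is the
member of index `-n`, and their measures multiply to one (`haar_filt_mul_haar_filt_neg`). A test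
function is periodic under one member and supported in another. The transform exchanges these two
properties, and inversion becomes an average over a coset on which the function is constant.
Parseval and density then make the closure of the graph on test functions the graph of a unitary
operator.

For the kernel, a ball of radius `R ≥ 1` has measure at most `R ^ |S|`, so the symbol `exp(-t m)`
lies in `L¹ ∩ L²` and `Z(·, t)` lies in `L²`. The convolution therefore converges at every point by
Cauchy–Schwarz, and inversion applied to `exp(-t m) f̂ ∈ L¹ ∩ L²` identifies it with `heatOp`
(`heatOp_ae_eq_convolution`). -/

theorem norm_sub_fracPart (x : ℚ_[p]) :
    ∃ a n : ℕ, fracPart x = (a : ℝ) / (p : ℝ) ^ n ∧ ‖x - (a : ℚ_[p]) / (p : ℚ_[p]) ^ n‖ ≤ 1 := by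
  set n := (-x.valuation).toNat
  set z : ℤ_[p] := ⟨x * (p : ℚ_[p]) ^ n, norm_mul_pow_le_one x⟩
  refine ⟨z.appr n, n, rfl, ?_⟩
  have hp0 : (p : ℚ_[p]) ≠ 0 := by exact_mod_cast (Fact.out : p.Prime).ne_zero
  have h := (PadicInt.norm_le_pow_iff_mem_span_pow _ _).2 (PadicInt.appr_spec n z)
  have h2 : ‖x * (p : ℚ_[p]) ^ n - (z.appr n : ℚ_[p])‖ ≤ (p : ℝ) ^ (-n : ℤ) := by
    rwa [PadicInt.norm_def, PadicInt.coe_sub, PadicInt.coe_natCast] at h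
  have h3 : x - (z.appr n : ℚ_[p]) / (p : ℚ_[p]) ^ n =
      (x * (p : ℚ_[p]) ^ n - (z.appr n : ℚ_[p])) / (p : ℚ_[p]) ^ n := by
    field_simp
  have hp : (0 : ℝ) < p := by exact_mod_cast (Fact.out : p.Prime).pos
  rw [h3, norm_div, norm_pow, Padic.norm_p]
  rw [zpow_neg, zpow_natCast] at h2
  rw [inv_pow, div_le_one (by positivity)]
  exact h2

/-- A rational number with denominator a power of `p` that is a `p`-adic integer is an integer. -/
theorem exists_int_of_norm_le_one {c : ℤ} {n : ℕ} (h : ‖(c : ℚ_[p]) / (p : ℚ_[p]) ^ n‖ ≤ 1) :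
    ∃ m : ℤ, (c : ℝ) / (p : ℝ) ^ n = m := by
  have hp : (0 : ℝ) < p := by exact_mod_cast (Fact.out : p.Prime).pos
  have h2 : ‖(c : ℚ_[p])‖ ≤ (p : ℝ) ^ (-n : ℤ) := by
    rw [norm_div, norm_pow, Padic.norm_p, inv_pow, div_le_one (by positivity)] at h
    rwa [zpow_neg, zpow_natCast]
  obtain ⟨m, hm⟩ := (Padic.norm_int_le_pow_iff_dvd c n).1 h2
  refine ⟨m, ?_⟩
  rw [hm]
  push_cast
  field_simp

/-- The defect is a rational number with `p`-power denominator, and up to sign a sum of three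
`p`-adic integers; such a number is an integer. -/
theorem fracPart_add (x y : ℚ_[p]) :
    ∃ m : ℤ, fracPart (x + y) = fracPart x + fracPart y + m := by
  obtain ⟨a, k, ha, hx⟩ := norm_sub_fracPart x
  obtain ⟨b, l, hb, hy⟩ := norm_sub_fracPart y
  obtain ⟨c, n, hc, hxy⟩ := norm_sub_fracPart (x + y)
  have hp0 : (p : ℚ_[p]) ≠ 0 := by exact_mod_cast (Fact.out : p.Prime).ne_zero
  have hpr : (p : ℝ) ≠ 0 := by exact_mod_cast (Fact.out : p.Prime).ne_zero
  have key : ‖(((c * p ^ (k + l) - a * p ^ (l + n) - b * p ^ (k + n) : ℤ)) : ℚ_[p]) /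
      (p : ℚ_[p]) ^ (k + l + n)‖ ≤ 1 := by
    have : (((c * p ^ (k + l) - a * p ^ (l + n) - b * p ^ (k + n) : ℤ)) : ℚ_[p]) /
      (p : ℚ_[p]) ^ (k + l + n) = (x - (a : ℚ_[p]) / (p : ℚ_[p]) ^ k) +
        (y - (b : ℚ_[p]) / (p : ℚ_[p]) ^ l) - (x + y - (c : ℚ_[p]) / (p : ℚ_[p]) ^ n) := by
      push_cast
      field_simp
      ring
    rw [this, sub_eq_add_neg _ (x + y - _)]
    refine (IsUltrametricDist.norm_add_le_max _ _).trans (max_le ?_ (by rwa [norm_neg]))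
    exact (IsUltrametricDist.norm_add_le_max _ _).trans (max_le hx hy)
  obtain ⟨m, hm⟩ := exists_int_of_norm_le_one key
  refine ⟨m, ?_⟩
  rw [← hm, ha, hb, hc]
  push_cast
  field_simp
  ring

/-- The canonical additive character of `ℚ_p`. -/
def localChar (x : ℚ_[p]) : ℂ := Complex.exp (2 * Real.pi * Complex.I * (fracPart x : ℝ))

theorem localChar_add (x y : ℚ_[p]) : localChar (x + y) = localChar x * localChar y := by
  obtain ⟨m, hm⟩ := fracPart_add x y
  rw [localChar, localChar, localChar, hm, ← Complex.exp_add]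
  rw [Complex.exp_eq_exp_iff_exists_int]
  exact ⟨m, by push_cast; ring⟩

theorem norm_localChar (x : ℚ_[p]) : ‖localChar x‖ = 1 := by
  rw [localChar, show 2 * (Real.pi : ℂ) * Complex.I * ((fracPart x : ℝ) : ℂ) =
    ((2 * Real.pi * fracPart x : ℝ) : ℂ) * Complex.I by push_cast; ring]
  exact Complex.norm_exp_ofReal_mul_I _

theorem localChar_eq_one_iff (x : ℚ_[p]) : localChar x = 1 ↔ ‖x‖ ≤ 1 := by
  constructor
  · intro h
    obtain ⟨a, n, ha, hx⟩ := norm_sub_fracPart x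
    obtain ⟨m, hm⟩ := Complex.exp_eq_one_iff.1 h
    have h1 : fracPart x = m := by
      have : (2 * Real.pi * Complex.I : ℂ) ≠ 0 := Complex.two_pi_I_ne_zero
      have h2 : ((fracPart x : ℝ) : ℂ) = m := by
        apply mul_left_cancel₀ this
        rw [hm]; ring
      exact_mod_cast h2
    have hp0 : (p : ℚ_[p]) ≠ 0 := by exact_mod_cast (Fact.out : p.Prime).ne_zero
    have hpr : (p : ℝ) ≠ 0 := by exact_mod_cast (Fact.out : p.Prime).ne_zero
    have h3 : (a : ℤ) = m * p ^ n := by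
      have h4 : (a : ℝ) = m * (p : ℝ) ^ n := by
        rw [← h1, ha]; field_simp
      exact_mod_cast h4
    have h5 : (a : ℚ_[p]) / (p : ℚ_[p]) ^ n = (m : ℤ) := by
      have : (a : ℚ_[p]) = (m : ℚ_[p]) * (p : ℚ_[p]) ^ n := by
        exact_mod_cast congrArg (Int.cast : ℤ → ℚ_[p]) h3
      rw [this]; field_simp
    rw [h5] at hx
    have : x = (x - (m : ℤ)) + (m : ℤ) := by ring
    rw [this]
    exact (IsUltrametricDist.norm_add_le_max _ _).trans (max_le hx (Padic.norm_int_le_one m))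
  · intro h
    -- For a `p`-adic integer the truncation has no digits.
    have hv : (-x.valuation).toNat = 0 := by
      by_cases hx : x = 0
      · simp [hx]
      · rw [Padic.norm_le_one_iff_val_nonneg] at h
        omega
    have : fracPart x = 0 := by
      have h0 : ∀ (n : ℕ) (z : ℤ_[p]), n = 0 → (z.appr n : ℝ) / (p : ℝ) ^ n = 0 := by
        rintro n z rfl; simp [PadicInt.appr]
      exact h0 _ _ hv
    rw [localChar, this]; simp

end Local

/-! ### The canonical character of `ℚ_S` -/

variable {S : Finset Nat.Primes}

theorem chi_eq_prod (x : QS S) : chi x = ∏ p : S, localChar (x p) := rfl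

theorem chi_add (x y : QS S) : chi (x + y) = chi x * chi y := by
  simp only [chi_eq_prod, Pi.add_apply, localChar_add, Finset.prod_mul_distrib]

theorem norm_chi (x : QS S) : ‖chi x‖ = 1 := by
  simp [chi_eq_prod, norm_prod, norm_localChar]

theorem chi_eq_one {x : QS S} (h : ∀ p, ‖x p‖ ≤ 1) : chi x = 1 := by
  rw [chi_eq_prod]
  exact Finset.prod_eq_one fun p _ => (localChar_eq_one_iff _).2 (h p)

theorem chi_zero : chi (0 : QS S) = 1 := chi_eq_one fun p => by simp

theorem chi_neg (x : QS S) : chi (-x) = starRingEnd ℂ (chi x) := by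
  have h : chi (-x) * chi x = 1 := by rw [← chi_add, neg_add_cancel, chi_zero]
  have h2 : starRingEnd ℂ (chi x) * chi x = 1 := by
    rw [mul_comm, Complex.mul_conj, Complex.normSq_eq_norm_sq, norm_chi]; simp
  have h3 : chi x ≠ 0 := by
    intro h0; rw [h0] at h; simp at h
  exact mul_right_cancel₀ h3 (h.trans h2.symm)

/-! ### The filtration -/

theorem chebLcm_pos (n : ℕ) : 0 < chebLcm S n := by
  classical
  rw [Nat.pos_iff_ne_zero, chebLcm, ne_eq, Finset.lcm_eq_zero_iff]
  simp only [id, not_exists, not_and, Finset.mem_filter, Finset.mem_Icc]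
  intro m hm h0
  omega

theorem chebLcm_dvd {m n : ℕ} (h : m ≤ n) : chebLcm S m ∣ chebLcm S n := by
  classical
  apply Finset.lcm_mono
  intro k hk
  simp only [Finset.mem_filter, Finset.mem_Icc] at hk ⊢
  exact ⟨⟨hk.1.1, hk.1.2.trans h⟩, hk.2⟩

theorem pow_dvd_chebLcm {p : Nat.Primes} (hp : p ∈ S) {l n : ℕ} (h : (p : ℕ) ^ l ≤ n) :
    (p : ℕ) ^ l ∣ chebLcm S n := by
  classical
  apply Finset.dvd_lcm (f := id)
  simp only [Finset.mem_filter, Finset.mem_Icc]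
  exact ⟨⟨Nat.one_le_pow _ _ p.2.pos, h⟩, p, hp, l, rfl⟩

theorem expPsi_natCast (n : ℕ) : expPsi S n = chebLcm S n := by
  rcases Nat.eq_zero_or_pos n with rfl | h
  · have : chebLcm S 0 = 1 := by simp [chebLcm]
    simp [expPsi, this]
  · simp [expPsi, Int.sign_eq_one_of_pos (by exact_mod_cast h : (0 : ℤ) < n)]

theorem expPsi_neg (n : ℤ) : expPsi S (-n) = (expPsi S n)⁻¹ := by
  simp [expPsi, Int.sign_neg]

theorem expPsi_pos (n : ℤ) : 0 < expPsi S n := by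
  have := chebLcm_pos (S := S) n.natAbs
  unfold expPsi; positivity

/-- The lcms divide each other as the index grows, and inverting reverses divisibility.
Multiplication by a natural number cannot increase a `p`-adic norm, so this makes the filtration
decreasing. -/
theorem exists_expPsi_eq_mul {m n : ℤ} (h : m ≤ n) :
    ∃ k : ℕ, expPsi S n = expPsi S m * k := by
  obtain ⟨a, rfl | rfl⟩ := m.eq_nat_or_neg
  · obtain ⟨b, rfl⟩ := Int.eq_ofNat_of_zero_le ((Int.natCast_nonneg a).trans h)
    obtain ⟨k, hk⟩ := chebLcm_dvd (S := S) (m := a) (n := b) (by omega)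
    exact ⟨k, by rw [expPsi_natCast, expPsi_natCast, hk]; push_cast; ring⟩
  · have ha : (chebLcm S a : ℚ) ≠ 0 := by exact_mod_cast (chebLcm_pos a).ne'
    obtain ⟨b, rfl | rfl⟩ := n.eq_nat_or_neg
    · refine ⟨chebLcm S a * chebLcm S b, ?_⟩
      rw [expPsi_neg, expPsi_natCast, expPsi_natCast]
      push_cast; field_simp
    · obtain ⟨k, hk⟩ := chebLcm_dvd (S := S) (m := b) (n := a) (by omega)
      have hb : (chebLcm S b : ℚ) ≠ 0 := by exact_mod_cast (chebLcm_pos b).ne'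
      refine ⟨k, ?_⟩
      rw [expPsi_neg, expPsi_neg, expPsi_natCast, expPsi_natCast, hk]
      have hk0 : (k : ℚ) ≠ 0 := by
        rintro h0
        have : k = 0 := by exact_mod_cast h0
        rw [hk, this] at ha; simp at ha
      push_cast; field_simp

/-- The radius of `e ^ ψ(n) ℤ_S` in the direction of `p`. -/
def radius (S : Finset Nat.Primes) (n : ℤ) (p : S) : ℝ :=
  ‖(expPsi S n : ℚ_[((p : Nat.Primes) : ℕ)])‖

theorem expPsi_cast_ne_zero (n : ℤ) (p : S) :
    (expPsi S n : ℚ_[((p : Nat.Primes) : ℕ)]) ≠ 0 := by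
  exact_mod_cast (expPsi_pos n).ne'

theorem radius_pos (n : ℤ) (p : S) : 0 < radius S n p := norm_pos_iff.2 (expPsi_cast_ne_zero n p)

theorem radius_neg (n : ℤ) (p : S) : radius S (-n) p = (radius S n p)⁻¹ := by
  rw [radius, radius, expPsi_neg, Rat.cast_inv, norm_inv]

theorem radius_anti {m n : ℤ} (h : m ≤ n) (p : S) : radius S n p ≤ radius S m p := by
  obtain ⟨k, hk⟩ := exists_expPsi_eq_mul (S := S) h
  rw [radius, hk, Rat.cast_mul, norm_mul, Rat.cast_natCast]
  have := Padic.norm_int_le_one (p := ((p : Nat.Primes) : ℕ)) k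
  rw [Int.cast_natCast] at this
  exact mul_le_of_le_one_right (norm_nonneg _) this

theorem exists_radius_lt {ε : ℝ} (hε : 0 < ε) (p : S) : ∃ n : ℕ, radius S n p < ε := by
  obtain ⟨l, hl⟩ := PadicInt.exists_pow_neg_lt ((p : Nat.Primes) : ℕ) hε
  -- At the index `p ^ l` the power `p ^ l` itself enters the lcm.
  refine ⟨((p : Nat.Primes) : ℕ) ^ l, lt_of_le_of_lt ?_ hl⟩
  rw [radius, expPsi_natCast, Rat.cast_natCast]
  have := (Padic.norm_int_le_pow_iff_dvd (p := ((p : Nat.Primes) : ℕ))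
    (chebLcm S (((p : Nat.Primes) : ℕ) ^ l)) l).2
    (by exact_mod_cast pow_dvd_chebLcm p.2 le_rfl)
  simpa using this

theorem exists_forall_radius_lt {ε : ℝ} (hε : 0 < ε) : ∃ n : ℤ, ∀ p : S, radius S n p < ε := by
  choose f hf using fun p : S => exists_radius_lt hε p
  refine ⟨((Finset.univ.sup f : ℕ) : ℤ), fun p => lt_of_le_of_lt (radius_anti ?_ p) (hf p)⟩
  exact_mod_cast Finset.le_sup (f := f) (Finset.mem_univ p)

theorem mem_filt_iff {n : ℤ} {x : QS S} : x ∈ filt S n ↔ ∀ p, ‖x p‖ ≤ radius S n p := by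
  constructor
  · rintro ⟨z, hz, rfl⟩ p
    rw [norm_mul]
    exact mul_le_of_le_one_right (norm_nonneg _) (hz p)
  · intro h
    refine ⟨fun p => (expPsi S n : ℚ_[((p : Nat.Primes) : ℕ)])⁻¹ * x p, fun p => ?_, ?_⟩
    · rw [norm_mul, norm_inv]
      exact (inv_mul_le_iff₀ (radius_pos n p)).2 (by simpa using h p)
    · ext p
      exact (mul_inv_cancel_left₀ (expPsi_cast_ne_zero n p) _).symm

theorem filt_eq_pi (n : ℤ) :
    filt S n = Set.univ.pi fun p => Metric.closedBall 0 (radius S n p) := by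
  ext x; simp [mem_filt_iff]

theorem filt_anti {m n : ℤ} (h : m ≤ n) : filt S n ⊆ filt S m := fun _ hx =>
  mem_filt_iff.2 fun p => (mem_filt_iff.1 hx p).trans (radius_anti h p)

/-- `e ^ ψ(n) ℤ_S` as an additive subgroup. -/
def filtSubgroup (S : Finset Nat.Primes) (n : ℤ) : AddSubgroup (QS S) where
  carrier := filt S n
  zero_mem' := mem_filt_iff.2 fun p => by simpa using (radius_pos n p).le
  add_mem' hx hy := mem_filt_iff.2 fun p => (IsUltrametricDist.norm_add_le_max _ _).trans
    (max_le (mem_filt_iff.1 hx p) (mem_filt_iff.1 hy p))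
  neg_mem' hx := mem_filt_iff.2 fun p => by simpa using mem_filt_iff.1 hx p

theorem zero_mem_filt (n : ℤ) : (0 : QS S) ∈ filt S n := (filtSubgroup S n).zero_mem

theorem neg_mem_filt {n : ℤ} {x : QS S} : -x ∈ filt S n ↔ x ∈ filt S n :=
  (filtSubgroup S n).neg_mem_iff

theorem add_mem_filt {n : ℤ} {x y : QS S} (hx : x ∈ filt S n) (hy : y ∈ filt S n) :
    x + y ∈ filt S n := (filtSubgroup S n).add_mem hx hy

theorem add_mem_filt_iff {n : ℤ} {x y : QS S} (hy : y ∈ filt S n) :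
    x + y ∈ filt S n ↔ x ∈ filt S n := (filtSubgroup S n).add_mem_cancel_right hy

theorem isCompact_filt (n : ℤ) : IsCompact (filt S n) := by
  rw [filt_eq_pi]; exact isCompact_univ_pi fun p => isCompact_closedBall _ _

theorem isOpen_filt (n : ℤ) : IsOpen (filt S n) := by
  rw [filt_eq_pi]
  exact isOpen_set_pi Set.finite_univ fun p _ =>
    IsUltrametricDist.isOpen_closedBall _ (radius_pos n p).ne'

theorem measurableSet_filt (n : ℤ) : MeasurableSet (filt S n) := (isOpen_filt n).measurableSet

theorem filt_mem_nhds_zero (n : ℤ) : filt S n ∈ 𝓝 (0 : QS S) :=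
  (isOpen_filt n).mem_nhds (zero_mem_filt n)

theorem exists_filt_subset_ball {ε : ℝ} (hε : 0 < ε) :
    ∃ n : ℤ, filt S n ⊆ Metric.ball 0 ε := by
  obtain ⟨n, hn⟩ := exists_forall_radius_lt (S := S) hε
  refine ⟨n, fun x hx => ?_⟩
  rw [mem_ball_zero_iff, pi_norm_lt_iff hε]
  exact fun p => (mem_filt_iff.1 hx p).trans_lt (hn p)

theorem exists_subset_filt {K : Set (QS S)} (hK : IsCompact K) : ∃ n : ℤ, K ⊆ filt S n := by
  obtain ⟨R, hR, hKR⟩ := hK.isBounded.subset_closedBall_lt 0 0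
  obtain ⟨n, hn⟩ := exists_forall_radius_lt (S := S) (inv_pos.2 hR)
  refine ⟨-n, fun x hx => mem_filt_iff.2 fun p => ?_⟩
  rw [radius_neg]
  have h1 := mem_closedBall_zero_iff.1 (hKR hx)
  exact ((norm_le_pi_norm x p).trans h1).trans
    ((le_inv_comm₀ hR (radius_pos n p)).2 (hn p).le)

theorem chi_eq_one_of_mem {n : ℤ} {x ξ : QS S} (hx : x ∈ filt S n) (hξ : ξ ∈ filt S (-n)) :
    chi (ξ * x) = 1 := by
  apply chi_eq_one
  intro p
  have h1 := mem_filt_iff.1 hx p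
  have h2 := mem_filt_iff.1 hξ p
  rw [radius_neg] at h2
  rw [Pi.mul_apply, norm_mul]
  calc ‖ξ p‖ * ‖x p‖ ≤ (radius S n p)⁻¹ * radius S n p :=
        mul_le_mul h2 h1 (norm_nonneg _) (inv_nonneg.2 (radius_pos n p).le)
    _ = 1 := inv_mul_cancel₀ (radius_pos n p).ne'

/-- `e ^ ψ(-n) ℤ_S` is the annihilator of `e ^ ψ(n) ℤ_S`. -/
theorem exists_chi_ne_one {n : ℤ} {ξ : QS S} (hξ : ξ ∉ filt S (-n)) :
    ∃ x ∈ filt S n, chi (ξ * x) ≠ 1 := by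
  classical
  rw [mem_filt_iff, not_forall] at hξ
  obtain ⟨p, hp⟩ := hξ
  rw [radius_neg, not_le] at hp
  -- In a coordinate `p` where `ξ` is too large, the extremal element of the subgroup, extended by
  -- zero, is moved by `ξ` out of `ℤ_p`.
  refine ⟨Pi.single p (expPsi S n : ℚ_[((p : Nat.Primes) : ℕ)]), mem_filt_iff.2 fun q => ?_, ?_⟩
  · by_cases h : q = p
    · subst h; simp [radius]
    · simpa [Pi.single_eq_of_ne h] using (radius_pos n q).le
  · rw [chi_eq_prod, Finset.prod_eq_single p]
    · rw [ne_eq, localChar_eq_one_iff, not_le, Pi.mul_apply, Pi.single_eq_same, norm_mul]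
      calc (1 : ℝ) = (radius S n p)⁻¹ * radius S n p := (inv_mul_cancel₀ (radius_pos n p).ne').symm
        _ < ‖ξ p‖ * radius S n p := by gcongr; exact radius_pos n p
    · intro q _ h
      rw [localChar_eq_one_iff, Pi.mul_apply, Pi.single_eq_of_ne h]; simp
    · simp

theorem isLocallyConstant_chi : IsLocallyConstant (chi : QS S → ℂ) := by
  rw [IsLocallyConstant.iff_eventually_eq]
  intro x
  have h : ∀ᶠ y in 𝓝 x, y - x ∈ filt S 0 := by
    have : Tendsto (fun y => y - x) (𝓝 x) (𝓝 0) := by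
      have := ((continuous_id (X := QS S)).sub (continuous_const (y := x))).tendsto x
      rwa [Pi.sub_apply, id, sub_self] at this
    exact this (filt_mem_nhds_zero 0)
  filter_upwards [h] with y hy
  have h1 : chi (y - x) = 1 := by
    have := chi_eq_one_of_mem (n := 0) (ξ := 1) hy (by
      rw [mem_filt_iff]; intro p; rw [radius_neg]; simp [radius, expPsi])
    rwa [one_mul] at this
  have : chi y = chi (x + (y - x)) := by congr 1; ring
  rw [this, chi_add, h1, mul_one]

theorem continuous_chi : Continuous (chi : QS S → ℂ) := isLocallyConstant_chi.continuous

/-! ### Haar measure of the filtration -/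

instance isAddHaarMeasure_haar : (haar S).IsAddHaarMeasure := by unfold haar; infer_instance

open scoped Pointwise in
-- Each member of the filtration is the dilate of `ℤ_S` by a unit of `ℚ_S`, so its measure is the
-- modulus of that unit, which is multiplicative. This is what makes the constant in Fourier
-- inversion equal to one.
theorem haar_filt_mul_haar_filt_neg (n : ℤ) : haar S (filt S n) * haar S (filt S (-n)) = 1 := by
  let e : ∀ m : ℤ, (QS S)ˣ := fun m =>
    { val := fun p => (expPsi S m : ℚ_[((p : Nat.Primes) : ℕ)])
      inv := fun p => (expPsi S m : ℚ_[((p : Nat.Primes) : ℕ)])⁻¹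
      val_inv := by ext p; exact mul_inv_cancel₀ (expPsi_cast_ne_zero m p)
      inv_val := by ext p; exact inv_mul_cancel₀ (expPsi_cast_ne_zero m p) }
  have hone : haar S {z | ∀ p : S, ‖z p‖ ≤ 1} = 1 := by
    have : {z : QS S | ∀ p : S, ‖z p‖ ≤ 1} = Set.univ.pi fun p => Metric.closedBall 0 1 := by
      ext z; simp
    rw [this, haar, Measure.pi_pi]
    exact Finset.prod_eq_one fun p _ =>
      Measure.addHaarMeasure_self (K₀ := padicUnitBall ((p : Nat.Primes) : ℕ))
  have hf : ∀ m : ℤ, haar S (filt S m) = distribHaarChar (QS S) (e m) := by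
    intro m
    have h1 := distribHaarChar_mul (haar S) (e m) {z | ∀ p : S, ‖z p‖ ≤ 1}
    rw [hone, mul_one] at h1
    rw [h1]
    congr 1
    ext x
    rw [Set.mem_smul_set]
    constructor
    · rintro ⟨z, hz, rfl⟩; exact ⟨z, hz, rfl⟩
    · rintro ⟨z, hz, rfl⟩; exact ⟨z, hz, rfl⟩
  have he : e n * e (-n) = 1 := by
    ext p
    change (expPsi S n : ℚ_[((p : Nat.Primes) : ℕ)]) *
      (expPsi S (-n) : ℚ_[((p : Nat.Primes) : ℕ)]) = 1
    rw [expPsi_neg, Rat.cast_inv]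
    exact mul_inv_cancel₀ (expPsi_cast_ne_zero n p)
  rw [hf, hf, ← ENNReal.coe_mul, ← map_mul, he, map_one, ENNReal.coe_one]

theorem haar_filt_lt_top (n : ℤ) : haar S (filt S n) < ∞ := (isCompact_filt n).measure_lt_top

theorem haar_real_filt_mul (n : ℤ) :
    (haar S).real (filt S n) * (haar S).real (filt S (-n)) = 1 := by
  rw [Measure.real, Measure.real, ← ENNReal.toReal_mul, haar_filt_mul_haar_filt_neg,
    ENNReal.toReal_one]

/-- Choose `p ^ k ≤ R < p ^ (k + 1)`. Norms are powers of `p`, so the ball is covered by the `p ^ k`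
translates of `ℤ_p` by `a / p ^ k`, `0 ≤ a < p ^ k`. -/
theorem haar_closedBall_le (p : ℕ) [Fact p.Prime] {R : ℝ} (hR : 1 ≤ R) :
    Measure.addHaarMeasure (padicUnitBall p) (Metric.closedBall (0 : ℚ_[p]) R) ≤
      ENNReal.ofReal R := by
  have hp1 : (1 : ℝ) < p := by exact_mod_cast (Fact.out : p.Prime).one_lt
  have hp0 : (p : ℚ_[p]) ≠ 0 := by exact_mod_cast (Fact.out : p.Prime).ne_zero
  obtain ⟨k, hk1, hk2⟩ := exists_nat_pow_near hR hp1
  have hsub : Metric.closedBall (0 : ℚ_[p]) R ⊆ ⋃ a ∈ Finset.range (p ^ k),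
      (fun x => -((a : ℚ_[p]) / (p : ℚ_[p]) ^ k) + x) ⁻¹' Metric.closedBall (0 : ℚ_[p]) 1 := by
    intro x hx
    rw [mem_closedBall_zero_iff] at hx
    have hxk : ‖x‖ ≤ (p : ℝ) ^ k := by
      by_cases h0 : x = 0
      · subst h0; simp
      · rw [Padic.norm_eq_zpow_neg_valuation h0] at hx ⊢
        rw [← zpow_natCast, zpow_le_zpow_iff_right₀ hp1]
        have := hx.trans_lt hk2
        rw [← zpow_natCast, zpow_lt_zpow_iff_right₀ hp1] at this
        push_cast at this
        omega
    have hz : ‖x * (p : ℚ_[p]) ^ k‖ ≤ 1 := by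
      rw [norm_mul, norm_pow, Padic.norm_p, inv_pow]
      exact mul_inv_le_one_of_le₀ hxk (by positivity)
    obtain ⟨z, hzx⟩ : ∃ z : ℤ_[p], (z : ℚ_[p]) = x * (p : ℚ_[p]) ^ k := ⟨⟨_, hz⟩, rfl⟩
    simp only [Set.mem_iUnion, Finset.mem_range]
    refine ⟨z.appr k, z.appr_lt k, ?_⟩
    have h := (PadicInt.norm_le_pow_iff_mem_span_pow _ _).2 (PadicInt.appr_spec k z)
    rw [PadicInt.norm_def, PadicInt.coe_sub, PadicInt.coe_natCast, hzx, zpow_neg,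
      zpow_natCast] at h
    rw [Set.mem_preimage, mem_closedBall_zero_iff]
    have h3 : -((z.appr k : ℚ_[p]) / (p : ℚ_[p]) ^ k) + x =
      (x * (p : ℚ_[p]) ^ k - (z.appr k : ℚ_[p])) / (p : ℚ_[p]) ^ k := by
      field_simp; ring
    rw [h3, norm_div, norm_pow, Padic.norm_p, inv_pow]
    exact (div_le_one (by positivity)).2 h
  refine (measure_mono hsub).trans ((measure_biUnion_finset_le _ _).trans ?_)
  have hone : Measure.addHaarMeasure (padicUnitBall p) (Metric.closedBall (0 : ℚ_[p]) 1) = 1 :=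
    Measure.addHaarMeasure_self (K₀ := padicUnitBall p)
  simp only [measure_preimage_add, hone, Finset.sum_const, Finset.card_range, nsmul_eq_mul, mul_one]
  rw [← ENNReal.ofReal_natCast]
  exact ENNReal.ofReal_le_ofReal (by exact_mod_cast hk1)

/-! ### The norm of `ℚ_S` -/

/-- The supremum in `order` is attained: the filtration exhausts `ℚ_S` (nonempty) and intersects in
zero (bounded above). -/
theorem mem_filt_iff_le_order {x : QS S} (hx : x ≠ 0) {n : ℤ} :
    x ∈ filt S n ↔ n ≤ order x := by
  obtain ⟨m, hm⟩ := exists_subset_filt (isCompact_singleton (x := x))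
  have hne : {n : ℤ | x ∈ filt S n}.Nonempty := ⟨m, hm rfl⟩
  have hbdd : BddAbove {n : ℤ | x ∈ filt S n} := by
    obtain ⟨p, hp⟩ := Function.ne_iff.1 hx
    obtain ⟨k, hk⟩ := exists_radius_lt (norm_pos_iff.2 hp) p
    refine ⟨k, fun n hn => ?_⟩
    by_contra! h
    exact absurd ((mem_filt_iff.1 hn p).trans (radius_anti h.le p)) (not_le.2 hk)
  constructor
  · exact fun h => le_csSup hbdd h
  · exact fun h => filt_anti h (Int.csSup_mem hne hbdd)

theorem normS_nonneg (x : QS S) : 0 ≤ normS x := by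
  unfold normS
  split_ifs
  · exact le_rfl
  · exact inv_nonneg.2 (by exact_mod_cast (expPsi_pos _).le)

theorem measurable_normS : Measurable (normS : QS S → ℝ) := by
  intro T _
  -- Off zero the norm depends on the order alone, and a level set of the order is a difference of
  -- two consecutive members of the filtration.
  have : normS ⁻¹' T = (⋃ n : {n : ℤ // (((expPsi S n : ℚ) : ℝ)⁻¹) ∈ T},
      (filt S n \ filt S (n + 1)) \ {0}) ∪ {x : QS S | x = 0 ∧ (0 : ℝ) ∈ T} := by
    ext x
    by_cases hx : x = 0
    · subst hx; simp [normS]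
    · simp only [Set.mem_preimage, normS, Set.mem_union, Set.mem_iUnion,
        Set.mem_sdiff, Set.mem_singleton_iff, hx, not_false_eq_true, and_true,
        mem_filt_iff_le_order hx, Set.mem_ofPred_eq, false_and, or_false, not_le]
      constructor
      · exact fun h => ⟨⟨_, h⟩, le_rfl, by simp⟩
      · rintro ⟨⟨n, hn⟩, h1, h2⟩
        have : order x = n := le_antisymm (by simpa using Int.lt_add_one_iff.1 h2) h1
        rwa [this]
  rw [this]
  refine (MeasurableSet.iUnion fun n => ((measurableSet_filt _).diff (measurableSet_filt _)).diff
    isClosed_singleton.measurableSet).union ?_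
  by_cases h : (0 : ℝ) ∈ T
  · simp [h]
  · simp [h]

/-- Nonnegative order means that `x` lies in `ℤ_S`. At order `-n` the coordinate is bounded by the
`p`-part of `e ^ ψ(n)`, which is at most `e ^ ψ(n) = ‖x‖`. Comparing with the sup norm bounds the
measure of balls. -/
theorem norm_apply_le_normS (x : QS S) (p : S) : ‖x p‖ ≤ max 1 (normS x) := by
  by_cases hx : x = 0
  · simp [hx]
  have h1 := mem_filt_iff.1 ((mem_filt_iff_le_order hx).2 le_rfl) p
  refine h1.trans ?_
  rcases le_total 0 (order x) with h | h
  · refine (radius_anti h p).trans ((le_of_eq ?_).trans (le_max_left _ _))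
    simp [radius, expPsi]
  · refine le_trans ?_ (le_max_right _ _)
    obtain ⟨n, hn⟩ := Int.eq_ofNat_of_zero_le (neg_nonneg.2 h)
    rw [normS, if_neg hx, show order x = -(n : ℤ) by omega, radius_neg, expPsi_neg, radius,
      expPsi_natCast, Rat.cast_inv, inv_inv, Rat.cast_natCast, Rat.cast_natCast,
      Padic.norm_eq_zpow_neg_valuation (by exact_mod_cast (chebLcm_pos n).ne'),
      Padic.valuation_natCast, zpow_neg, inv_inv, zpow_natCast]
    exact_mod_cast Nat.le_of_dvd (chebLcm_pos n) pow_padicValNat_dvd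

theorem haar_normS_le {R : ℝ} (hR : 1 ≤ R) :
    haar S {x | normS x ≤ R} ≤ ENNReal.ofReal R ^ S.card := by
  have hsub : {x : QS S | normS x ≤ R} ⊆ Set.univ.pi fun p => Metric.closedBall 0 R := by
    intro x hx p _
    rw [mem_closedBall_zero_iff]
    exact (norm_apply_le_normS x p).trans (max_le hR hx)
  refine (measure_mono hsub).trans ?_
  rw [haar, Measure.pi_pi]
  refine (Finset.prod_le_prod' fun p _ => haar_closedBall_le _ hR).trans ?_
  simp

/-! ### Integrability of the heat symbol -/

theorem measurable_normS_rpow (α : ℝ) : Measurable (fun ξ : QS S => normS ξ ^ α) :=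
  measurable_normS.pow_const α

theorem measurable_exp_neg_normS (α t : ℝ) :
    Measurable (fun ξ : QS S => Real.exp (-t * normS ξ ^ α)) :=
  Real.measurable_exp.comp ((measurable_normS_rpow α).const_mul _)

theorem summable_pow_mul_exp_neg_rpow (d : ℕ) {α t : ℝ} (hα : 0 < α) (ht : 0 < t) :
    Summable fun k : ℕ => ((k : ℝ) + 1) ^ d * Real.exp (-t * (k : ℝ) ^ α) := by
  -- The exponent makes the right side `k ^ (-(d + 2))`; after the factor `k ^ d` a summable `k ^
  -- (-2)` remains.
  have h1 : (fun k : ℕ => Real.exp (-t * (k : ℝ) ^ α)) =O[atTop]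
      fun k : ℕ => ((k : ℝ) ^ α) ^ (-((d : ℝ) + 2) / α) :=
    ((isLittleO_exp_neg_mul_rpow_atTop ht _).comp_tendsto
      ((tendsto_rpow_atTop hα).comp tendsto_natCast_atTop_atTop)).isBigO
  have h2 : (fun k : ℕ => ((k : ℝ) + 1) ^ d) =O[atTop] fun k : ℕ => (k : ℝ) ^ d := by
    apply Asymptotics.IsBigO.pow
    apply Asymptotics.IsBigO.of_bound 2
    filter_upwards [eventually_ge_atTop 1] with k hk
    have : (1 : ℝ) ≤ k := by exact_mod_cast hk
    rw [Real.norm_of_nonneg (by positivity), Real.norm_of_nonneg (by positivity)]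
    linarith
  refine summable_of_isBigO_nat (Real.summable_nat_rpow_inv.2 (one_lt_two)) ((h2.mul h1).trans ?_)
  apply Asymptotics.IsBigO.of_bound 1
  filter_upwards [eventually_ge_atTop 1] with k hk
  have hk0 : (0 : ℝ) < k := by exact_mod_cast hk
  rw [one_mul, ← Real.rpow_mul hk0.le, mul_div_cancel₀ _ hα.ne', ← Real.rpow_natCast,
    ← Real.rpow_add hk0, ← Real.rpow_neg hk0.le]
  ring_nf
  exact le_rfl

/-- Cut into shells by `k = ⌊‖ξ‖⌋`: the shell has measure at most `(k + 1) ^ |S|`, and the integrand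
is at most `exp(-t k ^ α)` there. -/
theorem integrable_exp_neg_normS {α t : ℝ} (hα : 0 < α) (ht : 0 < t) :
    Integrable (fun ξ : QS S => Real.exp (-t * normS ξ ^ α)) (haar S) := by
  refine ⟨(measurable_exp_neg_normS α t).aestronglyMeasurable, ?_⟩
  have hle : ∀ ξ : QS S, ‖Real.exp (-t * normS ξ ^ α)‖ₑ ≤
      ∑' k : ℕ, {x : QS S | normS x ≤ (k : ℝ) + 1}.indicator
        (fun _ => ENNReal.ofReal (Real.exp (-t * (k : ℝ) ^ α))) ξ := by
    intro ξ
    have h1 := Nat.floor_le (normS_nonneg ξ)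
    refine le_trans ?_ (ENNReal.le_tsum ⌊normS ξ⌋₊)
    rw [Set.indicator_of_mem (show ξ ∈ {x : QS S | normS x ≤ (⌊normS ξ⌋₊ : ℝ) + 1}
      by rw [Set.mem_ofPred_eq]; exact (Nat.lt_floor_add_one _).le),
      Real.enorm_eq_ofReal (by positivity)]
    apply ENNReal.ofReal_le_ofReal
    apply Real.exp_le_exp.2
    have := Real.rpow_le_rpow (Nat.cast_nonneg _) h1 hα.le
    nlinarith
  refine (lintegral_mono hle).trans_lt ?_
  have hmeas : ∀ k : ℕ, MeasurableSet {x : QS S | normS x ≤ (k : ℝ) + 1} := fun k =>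
    measurable_normS measurableSet_Iic
  rw [lintegral_tsum fun k => (measurable_const.indicator (hmeas k)).aemeasurable]
  have hsum := (summable_pow_mul_exp_neg_rpow S.card hα ht).tsum_ofReal_lt_top
  refine lt_of_le_of_lt (ENNReal.tsum_le_tsum fun k => ?_) hsum
  rw [lintegral_indicator_const (hmeas k), mul_comm,
    ENNReal.ofReal_mul (by positivity), ENNReal.ofReal_pow (by positivity)]
  gcongr
  exact haar_normS_le (by simp)

/-! ### The Fourier transform of test functions -/

/-- Test functions: locally constant functions of compact support. -/
def IsTest (φ : QS S → ℂ) : Prop := IsLocallyConstant φ ∧ HasCompactSupport φ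

/-- Local constancy becomes uniform on the compact support: `φ(x + z) - φ(x)` vanishes near `filt S
m × {0}`, and the tube lemma gives one neighbourhood of zero for all `x`. With `IsTest.of_invariant`
this describes test functions purely by the filtration. -/
theorem IsTest.exists_invariant {φ : QS S → ℂ} (h : IsTest φ) :
    ∃ n m : ℤ, (∀ x, ∀ z ∈ filt S n, φ (x + z) = φ x) ∧ ∀ x, x ∉ filt S m → φ x = 0 := by
  obtain ⟨m, hm⟩ := exists_subset_filt h.2
  have hm0 : ∀ x, x ∉ filt S m → φ x = 0 := fun x hx =>
    image_eq_zero_of_notMem_tsupport fun h' => hx (hm h')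
  have hlc : IsLocallyConstant fun q : QS S × QS S => φ (q.1 + q.2) - φ q.1 :=
    (h.1.comp_continuous (continuous_fst.add continuous_snd)).sub
      (h.1.comp_continuous continuous_fst)
  have hopen := hlc.isOpen_fiber 0
  obtain ⟨u, v, -, hv, hKu, h0v, huv⟩ := generalized_tube_lemma (isCompact_filt (S := S) m)
    (isCompact_singleton (x := (0 : QS S))) hopen (by
      rintro ⟨x, z⟩ ⟨-, hz⟩
      rw [Set.mem_singleton_iff] at hz
      simp only at hz
      subst hz
      simp)
  obtain ⟨ε, hε, hball⟩ := Metric.isOpen_iff.1 hv 0 (h0v rfl)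
  obtain ⟨k, hk⟩ := exists_filt_subset_ball (S := S) hε
  -- Taking the index at least `m` makes the complement of `filt S m` stable under the translations,
  -- so both values vanish there.
  refine ⟨max k m, m, fun x z hz => ?_, hm0⟩
  by_cases hx : x ∈ filt S m
  · have := huv (Set.mk_mem_prod (hKu hx) (hball (hk (filt_anti (le_max_left _ _) hz))))
    exact sub_eq_zero.1 this
  · rw [hm0 x hx, hm0]
    rwa [add_mem_filt_iff (filt_anti (le_max_right k m) hz)]

theorem IsTest.of_invariant {φ : QS S → ℂ} {n m : ℤ}
    (hn : ∀ x, ∀ z ∈ filt S n, φ (x + z) = φ x) (hm : ∀ x, x ∉ filt S m → φ x = 0) :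
    IsTest φ := by
  refine ⟨(IsLocallyConstant.iff_eventually_eq _).2 fun x => ?_,
    HasCompactSupport.intro (isCompact_filt m) hm⟩
  have h : ∀ᶠ y in 𝓝 x, y - x ∈ filt S n := by
    have := ((continuous_id (X := QS S)).sub (continuous_const (y := x))).tendsto x
    rw [Pi.sub_apply, id, sub_self] at this
    exact this (filt_mem_nhds_zero n)
  filter_upwards [h] with y hy
  rw [← hn x _ hy, add_sub_cancel]

theorem IsTest.continuous {φ : QS S → ℂ} (h : IsTest φ) : Continuous φ := h.1.continuous

theorem IsTest.integrable {φ : QS S → ℂ} (h : IsTest φ) : Integrable φ (haar S) :=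
  h.continuous.integrable_of_hasCompactSupport h.2

theorem IsTest.memLp {φ : QS S → ℂ} (h : IsTest φ) : MemLp φ 2 (haar S) :=
  h.continuous.memLp_of_hasCompactSupport h.2

theorem IsTest.add {φ ψ : QS S → ℂ} (hφ : IsTest φ) (hψ : IsTest ψ) :
    IsTest (fun x => φ x + ψ x) := ⟨hφ.1.add hψ.1, hφ.2.add hψ.2⟩

theorem IsTest.const_mul {φ : QS S → ℂ} (hφ : IsTest φ) (c : ℂ) : IsTest (fun x => c * φ x) := by
  obtain ⟨n, m, hn, hm⟩ := hφ.exists_invariant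
  exact .of_invariant (n := n) (m := m) (fun x z hz => by rw [hn x z hz])
    (fun x hx => by rw [hm x hx, mul_zero])

theorem IsTest.comp_neg {φ : QS S → ℂ} (hφ : IsTest φ) : IsTest (fun x => φ (-x)) := by
  obtain ⟨n, m, hn, hm⟩ := hφ.exists_invariant
  refine .of_invariant (n := n) (m := m) (fun x z hz => ?_) (fun x hx => hm _ ?_)
  · rw [neg_add, hn _ _ (neg_mem_filt.2 hz)]
  · rwa [neg_mem_filt]

theorem IsTest.conj {φ : QS S → ℂ} (hφ : IsTest φ) : IsTest (fun x => starRingEnd ℂ (φ x)) := by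
  obtain ⟨n, m, hn, hm⟩ := hφ.exists_invariant
  exact .of_invariant (n := n) (m := m) (fun x z hz => by rw [hn x z hz])
    (fun x hx => by rw [hm x hx, map_zero])

theorem isTest_zero : IsTest (fun _ : QS S => (0 : ℂ)) :=
  .of_invariant (n := 0) (m := 0) (fun _ _ _ => rfl) (fun _ _ => rfl)

/-- The indicator function of `e ^ ψ(n) ℤ_S`. -/
def filtIndicator (S : Finset Nat.Primes) (n : ℤ) : QS S → ℂ := (filt S n).indicator 1

theorem filtIndicator_of_mem {n : ℤ} {x : QS S} (hx : x ∈ filt S n) : filtIndicator S n x = 1 :=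
  Set.indicator_of_mem hx _

theorem filtIndicator_of_notMem {n : ℤ} {x : QS S} (hx : x ∉ filt S n) :
    filtIndicator S n x = 0 := Set.indicator_of_notMem hx _

theorem filtIndicator_add {n : ℤ} (x : QS S) {z : QS S} (hz : z ∈ filt S n) :
    filtIndicator S n (x + z) = filtIndicator S n x := by
  by_cases hx : x ∈ filt S n
  · rw [filtIndicator_of_mem hx, filtIndicator_of_mem (add_mem_filt hx hz)]
  · rw [filtIndicator_of_notMem hx,
      filtIndicator_of_notMem (mt (add_mem_filt_iff hz).1 hx)]

theorem integral_filtIndicator (n : ℤ) :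
    ∫ x, filtIndicator S n x ∂(haar S) = (haar S).real (filt S n) := by
  have h : ∫ x, (filt S n).indicator (1 : QS S → ℂ) x ∂(haar S) =
      ∫ x in filt S n, (1 : ℂ) ∂(haar S) := integral_indicator (measurableSet_filt n)
  exact h.trans (by simp)

theorem isTest_filtIndicator_mul_chi (n : ℤ) (η : QS S) :
    IsTest (fun x => filtIndicator S n x * chi (η * x)) := by
  obtain ⟨k, hk⟩ := exists_subset_filt (isCompact_singleton (x := η))
  -- Since `η` lies in the member of index `k`, the character `chi (η * ·)` is trivial on the one of
  -- index `-k`.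
  refine .of_invariant (n := max n (-k)) (m := n) (fun x z hz => ?_) (fun x hx => ?_)
  · have h2 : chi (η * z) = 1 := chi_eq_one_of_mem (n := -k) (filt_anti (le_max_right _ _) hz)
      (by rw [neg_neg]; exact hk rfl)
    rw [mul_add, chi_add, h2, mul_one, filtIndicator_add x (filt_anti (le_max_left _ _) hz)]
  · rw [filtIndicator_of_notMem hx, zero_mul]

theorem isTest_filtIndicator (n : ℤ) : IsTest (filtIndicator S n) := by
  simpa [chi_zero] using isTest_filtIndicator_mul_chi n (0 : QS S)

theorem fourierIntegral_add_of_invariant {φ : QS S → ℂ} {m : ℤ}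
    (hm : ∀ x, x ∉ filt S m → φ x = 0) (ξ z : QS S) (hz : z ∈ filt S (-m)) :
    fourierIntegral φ (ξ + z) = fourierIntegral φ ξ := by
  refine integral_congr_ae (Eventually.of_forall fun x => ?_)
  by_cases hx : x ∈ filt S m
  · simp only [add_mul, chi_add, chi_eq_one_of_mem hx hz, mul_one]
  · simp [hm x hx]

/-- Translating the integral by `z` in the period group multiplies it by `chi (ξ * z)`, and some `z`
makes this factor different from one. -/
theorem fourierIntegral_eq_zero {φ : QS S → ℂ} {n : ℤ}
    (hn : ∀ x, ∀ z ∈ filt S n, φ (x + z) = φ x) {ξ : QS S} (hξ : ξ ∉ filt S (-n)) :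
    fourierIntegral φ ξ = 0 := by
  obtain ⟨z, hz, hχ⟩ := exists_chi_ne_one hξ
  have h : fourierIntegral φ ξ = fourierIntegral φ ξ * chi (ξ * z) := by
    conv_lhs => rw [fourierIntegral, ← integral_add_right_eq_self _ z]
    simp only [hn _ z hz, mul_add, chi_add, ← mul_assoc]
    rw [integral_mul_const]
    rfl
  by_contra h0
  exact hχ (mul_left_cancel₀ h0 (by rw [← h, mul_one]))

theorem IsTest.fourierIntegral {φ : QS S → ℂ} (h : IsTest φ) : IsTest (fourierIntegral φ) := by
  obtain ⟨n, m, hn, hm⟩ := h.exists_invariant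
  exact .of_invariant (fourierIntegral_add_of_invariant hm) fun ξ => fourierIntegral_eq_zero hn

theorem fourierIntegral_filtIndicator (n : ℤ) (ξ : QS S) :
    fourierIntegral (filtIndicator S n) ξ =
      (haar S).real (filt S n) * filtIndicator S (-n) ξ := by
  by_cases hξ : ξ ∈ filt S (-n)
  · have h : ∀ x, filtIndicator S n x * chi (ξ * x) = filtIndicator S n x := by
      intro x
      by_cases hx : x ∈ filt S n
      · rw [chi_eq_one_of_mem hx hξ, mul_one]
      · rw [filtIndicator_of_notMem hx, zero_mul]
    simp only [fourierIntegral, h]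
    rw [integral_filtIndicator, filtIndicator_of_mem hξ, mul_one]
  · rw [fourierIntegral_eq_zero (fun x z hz => filtIndicator_add x hz) hξ,
      filtIndicator_of_notMem hξ, mul_zero]

/-! ### Multiplication formula, inversion, Parseval and density -/

theorem integrable_mul_chi {f : QS S → ℂ} (hf : Integrable f (haar S)) (ξ : QS S) :
    Integrable (fun x => f x * chi (ξ * x)) (haar S) :=
  hf.mul_bdd (c := 1)
    (continuous_chi.comp (continuous_const.mul continuous_id)).aestronglyMeasurable
    (Eventually.of_forall fun _ => (norm_chi _).le)

theorem integrable_prod_mul_chi {f g : QS S → ℂ} (hf : Integrable f (haar S))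
    (hg : Integrable g (haar S)) :
    Integrable (fun q : QS S × QS S => f q.1 * g q.2 * chi (q.2 * q.1)) ((haar S).prod (haar S)) :=
  (hf.mul_prod hg).mul_bdd (c := 1)
    (continuous_chi.comp (continuous_snd.mul continuous_fst)).aestronglyMeasurable
    (Eventually.of_forall fun _ => (norm_chi _).le)

/-- The multiplication formula. -/
theorem integral_fourierIntegral_mul {f g : QS S → ℂ} (hf : Integrable f (haar S))
    (hg : Integrable g (haar S)) :
    ∫ ξ, fourierIntegral f ξ * g ξ ∂(haar S) = ∫ x, f x * fourierIntegral g x ∂(haar S) := by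
  have h := integral_integral_swap (f := fun x ξ => f x * g ξ * chi (ξ * x))
    (integrable_prod_mul_chi hf hg)
  have h1 : ∀ ξ, ∫ x, f x * g ξ * chi (ξ * x) ∂(haar S) = fourierIntegral f ξ * g ξ := by
    intro ξ
    rw [fourierIntegral, ← integral_mul_const]
    congr 1; ext x; ring
  have h2 : ∀ x, ∫ ξ, f x * g ξ * chi (ξ * x) ∂(haar S) = f x * fourierIntegral g x := by
    intro x
    rw [fourierIntegral, ← integral_const_mul]
    congr 1; ext ξ; rw [mul_comm ξ x]; ring
  simp only [h1, h2] at h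
  exact h.symm

/-- Fourier inversion for test functions. -/
theorem IsTest.fourierIntegral_fourierIntegral {φ : QS S → ℂ} (h : IsTest φ) (η : QS S) :
    SAdic.fourierIntegral (SAdic.fourierIntegral φ) η = φ (-η) := by
  obtain ⟨n, m, hn, hm⟩ := h.exists_invariant
  -- The transform of `φ` lives on `filt S (-n)`, so the indicator can be inserted. By the
  -- multiplication formula the double transform is then the mean of `φ` over the coset `-η + filt S
  -- n`, where `φ` is constant.
  have h1 : SAdic.fourierIntegral (SAdic.fourierIntegral φ) η =
      ∫ ξ, SAdic.fourierIntegral φ ξ * (filtIndicator S (-n) ξ * chi (η * ξ)) ∂(haar S) := by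
    refine integral_congr_ae (Eventually.of_forall fun ξ => ?_)
    by_cases hξ : ξ ∈ filt S (-n)
    · simp only [filtIndicator_of_mem hξ, one_mul]
    · simp only [fourierIntegral_eq_zero hn hξ, zero_mul]
  have h2 : ∀ y, SAdic.fourierIntegral (fun ξ => filtIndicator S (-n) ξ * chi (η * ξ)) y =
      (haar S).real (filt S (-n)) * filtIndicator S n (y + η) := by
    intro y
    rw [← neg_neg n, neg_neg (-n), ← fourierIntegral_filtIndicator]
    refine integral_congr_ae (Eventually.of_forall fun ξ => ?_)
    simp only [add_mul, chi_add]; ring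
  have h3 : ∀ y, φ (y - η) * ((haar S).real (filt S (-n)) * filtIndicator S n y) =
      φ (-η) * (haar S).real (filt S (-n)) * filtIndicator S n y := by
    intro y
    by_cases hy : y ∈ filt S n
    · rw [sub_eq_neg_add, hn _ _ hy, mul_assoc]
    · rw [filtIndicator_of_notMem hy, mul_zero, mul_zero, mul_zero]
  rw [h1, integral_fourierIntegral_mul h.integrable (isTest_filtIndicator_mul_chi _ _).integrable]
  simp only [h2]
  rw [← integral_sub_right_eq_self _ η]
  simp only [sub_add_cancel, h3]
  rw [integral_const_mul, integral_filtIndicator, mul_assoc]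
  have := haar_real_filt_mul (S := S) n
  rw [mul_comm] at this
  have h4 : (((haar S).real (filt S (-n)) : ℝ) : ℂ) * ((haar S).real (filt S n) : ℝ) = 1 := by
    exact_mod_cast this
  exact (congrArg (φ (-η) * ·) h4).trans (mul_one _)

theorem fourierIntegral_conj (ψ : QS S → ℂ) (ξ : QS S) :
    fourierIntegral (fun x => starRingEnd ℂ (ψ x)) ξ = starRingEnd ℂ (fourierIntegral ψ (-ξ)) := by
  simp only [fourierIntegral]
  rw [← integral_conj]
  simp only [map_mul, neg_mul, chi_neg, Complex.conj_conj]

theorem fourierIntegral_comp_neg (ψ : QS S → ℂ) (ξ : QS S) :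
    fourierIntegral (fun x => ψ (-x)) ξ = fourierIntegral ψ (-ξ) := by
  simp only [fourierIntegral]
  rw [← integral_neg_eq_self]
  simp only [neg_neg, mul_neg, neg_mul]

/-- Parseval's identity for test functions. -/
theorem IsTest.integral_fourierIntegral_mul_conj {φ : QS S → ℂ} (h : IsTest φ) :
    ∫ ξ, SAdic.fourierIntegral φ ξ * starRingEnd ℂ (SAdic.fourierIntegral φ ξ) ∂(haar S) =
      ∫ x, φ x * starRingEnd ℂ (φ x) ∂(haar S) := by
  rw [integral_fourierIntegral_mul h.integrable h.fourierIntegral.conj.integrable]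
  simp only [fourierIntegral_conj, h.fourierIntegral_fourierIntegral, neg_neg]

theorem IsTest.exists_fourierIntegral_eq {ψ : QS S → ℂ} (h : IsTest ψ) :
    ∃ φ : QS S → ℂ, IsTest φ ∧ SAdic.fourierIntegral φ = ψ := by
  refine ⟨fun x => SAdic.fourierIntegral ψ (-x), h.fourierIntegral.comp_neg, ?_⟩
  ext ξ
  rw [fourierIntegral_comp_neg, h.fourierIntegral_fourierIntegral, neg_neg]

/-- A continuous function of compact support is a uniform limit of test functions with supports in
a fixed compact set. -/
theorem exists_isTest_dist_le {g : QS S → ℂ} (hg : Continuous g) (hgs : HasCompactSupport g) :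
    ∃ m : ℤ, ∀ ε > 0, ∃ φ, IsTest φ ∧ ∀ x, ‖g x - φ x‖ ≤ (filt S m).indicator (fun _ => ε) x := by
  obtain ⟨m, hm⟩ := exists_subset_filt hgs
  have hm0 : ∀ x, x ∉ filt S m → g x = 0 := fun x hx =>
    image_eq_zero_of_notMem_tsupport fun h' => hx (hm h')
  refine ⟨m, fun ε hε => ?_⟩
  obtain ⟨δ, hδ, hgδ⟩ := Metric.uniformContinuous_iff.1
    (hgs.uniformContinuous_of_continuous hg) ε hε
  obtain ⟨k, hk⟩ := exists_filt_subset_ball (S := S) hδ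
  let N := filtSubgroup S (max k m)
  -- One representative is chosen in each coset of a small subgroup; sampling `g` there gives the
  -- step function.
  let r : QS S → QS S := fun x => (QuotientAddGroup.mk (s := N) x).out
  have hr : ∀ x, -x + r x ∈ filt S (max k m) := fun x =>
    QuotientAddGroup.eq.1 (QuotientAddGroup.out_eq' (QuotientAddGroup.mk (s := N) x)).symm
  have hrm : ∀ x, x ∉ filt S m → r x ∉ filt S m := by
    intro x hx hrx
    apply hx
    rw [← add_mem_filt_iff (filt_anti (le_max_right k m) (hr x))]
    simpa using hrx
  refine ⟨fun x => g (r x), .of_invariant (n := max k m) (m := m) (fun x z hz => ?_)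
    (fun x hx => hm0 _ (hrm x hx)), fun x => ?_⟩
  · have : QuotientAddGroup.mk (s := N) (x + z) = QuotientAddGroup.mk x :=
      QuotientAddGroup.mk_add_of_mem x hz
    simp only [r, this]
  · by_cases hx : x ∈ filt S m
    · rw [Set.indicator_of_mem hx]
      have h1 := hk (filt_anti (le_max_left k m) (hr x))
      rw [mem_ball_zero_iff] at h1
      have := hgδ (a := x) (b := r x) (by rw [dist_eq_norm, ← norm_neg]; convert h1 using 2; abel)
      rw [dist_eq_norm] at this
      exact this.le
    · rw [Set.indicator_of_notMem hx, hm0 x hx]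
      change ‖0 - g (r x)‖ ≤ 0
      rw [hm0 _ (hrm x hx)]; simp

/-- Test functions are dense in `L²(ℚ_S)`. -/
theorem dense_isTest : Dense {f : L2 S | ∃ φ, IsTest φ ∧ f =ᵐ[haar S] φ} := by
  intro f
  rw [EMetric.mem_closure_iff]
  intro ε hε
  obtain ⟨g, hgs, hfg, hgc, hgm⟩ := (Lp.memLp f).exists_hasCompactSupport_eLpNorm_sub_le
    (by simp) (ENNReal.half_pos hε.ne').ne'
  obtain ⟨m, hm⟩ := exists_isTest_dist_le hgc hgs
  -- A uniform error `δ` on the fixed compact set costs at most `δ` times the square root of its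
  -- measure in `L²`.
  have : Tendsto (fun δ : ℝ≥0 => (δ : ℝ≥0∞) * haar S (filt S m) ^ (1 / 2 : ℝ)) (𝓝 0) (𝓝 0) := by
    have h := ENNReal.Tendsto.mul_const (b := haar S (filt S m) ^ (1 / 2 : ℝ))
      ((ENNReal.continuous_coe.tendsto (0 : ℝ≥0)))
      (Or.inr (ENNReal.rpow_ne_top_of_nonneg (by norm_num) (haar_filt_lt_top m).ne))
    simpa using h
  obtain ⟨δ, hδ, hδ0⟩ := (((this.mono_left nhdsWithin_le_nhds).eventually
    (gt_mem_nhds (ENNReal.half_pos hε.ne'))).and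
    (self_mem_nhdsWithin : ∀ᶠ δ in 𝓝[>] (0 : ℝ≥0), δ ∈ Set.Ioi 0)).exists
  obtain ⟨φ, hφ, hgφ⟩ := hm δ hδ0
  refine ⟨hφ.memLp.toLp φ, ⟨φ, hφ, hφ.memLp.coeFn_toLp⟩, ?_⟩
  have h1 : eLpNorm (g - φ) 2 (haar S) ≤ δ * haar S (filt S m) ^ (1 / 2 : ℝ) := by
    refine (eLpNorm_mono_real hgφ).trans ?_
    refine (eLpNorm_indicator_const_le _ _).trans ?_
    simp
  have h2 : eLpNorm ((f : QS S → ℂ) - φ) 2 (haar S) < ε := by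
    have : (f : QS S → ℂ) - φ = (f - g) + (g - φ) := by abel
    rw [this]
    refine (eLpNorm_add_le ((Lp.memLp f).sub hgm).1 (hgm.sub hφ.memLp).1 (by norm_num)).trans_lt ?_
    rw [← ENNReal.add_halves ε]
    exact ENNReal.add_lt_add_of_le_of_lt ((Lp.memLp f).sub hgm).2.ne hfg (h1.trans_lt hδ)
  rw [Lp.edist_def]
  refine lt_of_eq_of_lt (eLpNorm_congr_ae ?_) h2
  exact (EventuallyEq.refl _ _).sub hφ.memLp.coeFn_toLp

/-! ### The Fourier transform on `L²` -/

/-! ### The bilinear pairing of `L²` -/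

section Pairing

variable {X : Type*} [MeasurableSpace X] {μ : Measure X}

theorem memLp_conj {h : X → ℂ} {p : ℝ≥0∞} (hh : MemLp h p μ) :
    MemLp (fun x => starRingEnd ℂ (h x)) p μ := hh.star

theorem integral_mul_eq_inner {h : X → ℂ} (hh : MemLp h 2 μ) (f : Lp ℂ 2 μ) :
    ∫ x, f x * h x ∂μ = inner ℂ ((memLp_conj hh).toLp _) f := by
  rw [L2.inner_def]
  refine integral_congr_ae ?_
  filter_upwards [(memLp_conj hh).coeFn_toLp] with x hx
  rw [hx, RCLike.inner_apply, RingHomCompTriple.comp_apply, RingHom.id_apply]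

theorem continuous_integral_mul {h : X → ℂ} (hh : MemLp h 2 μ) :
    Continuous fun f : Lp ℂ 2 μ => ∫ x, f x * h x ∂μ := by
  simp only [integral_mul_eq_inner hh]
  fun_prop

end Pairing

theorem IsTest.mul {φ ψ : QS S → ℂ} (hφ : IsTest φ) (hψ : IsTest ψ) :
    IsTest (fun x => φ x * ψ x) := ⟨hφ.1.mul hψ.1, hψ.2.mul_left⟩

/-- The pairing with `h` is continuous and vanishes on a dense set, hence also at the conjugate of
`h`, where it is the squared norm. -/
theorem ae_eq_zero_of_forall_isTest {h : QS S → ℂ} (hh : MemLp h 2 (haar S))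
    (h0 : ∀ ψ, IsTest ψ → ∫ x, h x * ψ x ∂(haar S) = 0) : h =ᵐ[haar S] 0 := by
  have h1 : (fun f : L2 S => ∫ x, f x * h x ∂(haar S)) = fun _ => 0 := by
    refine Continuous.ext_on dense_isTest (continuous_integral_mul hh) continuous_const ?_
    rintro f ⟨ψ, hψ, hfψ⟩
    rw [← h0 ψ hψ]
    refine integral_congr_ae ?_
    filter_upwards [hfψ] with x hx
    rw [hx, mul_comm]
  have h2 := congrFun h1 ((memLp_conj hh).toLp _)
  simp only [integral_mul_eq_inner hh, inner_self_eq_zero] at h2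
  have h3 := (memLp_conj hh).coeFn_toLp
  rw [h2] at h3
  filter_upwards [h3, Lp.coeFn_zero ℂ 2 (haar S)] with x hx hx0
  rw [hx0] at hx
  exact (map_eq_zero _).1 hx.symm

theorem norm_sq_eq_integral {f : L2 S} {φ : QS S → ℂ} (h : f =ᵐ[haar S] φ) :
    ((‖f‖ ^ 2 : ℝ) : ℂ) = ∫ x, φ x * starRingEnd ℂ (φ x) ∂(haar S) := by
  have h1 := inner_self_eq_norm_sq_to_K (𝕜 := ℂ) f
  rw [L2.inner_def] at h1
  push_cast
  refine h1.symm.trans (integral_congr_ae ?_)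
  filter_upwards [h] with x hx
  rw [hx, RCLike.inner_apply]

/-- The graph of the Fourier transform of test functions. -/
def testGraph (S : Finset Nat.Primes) : Submodule ℂ (L2 S × L2 S) where
  carrier := {q : L2 S × L2 S | ∃ φ : QS S → ℂ, IsLocallyConstant φ ∧ HasCompactSupport φ ∧
    q.1 =ᵐ[haar S] φ ∧ q.2 =ᵐ[haar S] fourierIntegral φ}
  zero_mem' := by
    refine ⟨fun _ => 0, isTest_zero.1, isTest_zero.2, Lp.coeFn_zero _ _ _, ?_⟩
    have : fourierIntegral (fun _ : QS S => (0 : ℂ)) = 0 := by ext; simp [fourierIntegral]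
    rw [this]
    exact Lp.coeFn_zero _ _ _
  add_mem' := by
    rintro ⟨f, f'⟩ ⟨g, g'⟩ ⟨φ, hφ1, hφ2, hf, hf'⟩ ⟨ψ, hψ1, hψ2, hg, hg'⟩
    have hφ : IsTest φ := ⟨hφ1, hφ2⟩
    have hψ : IsTest ψ := ⟨hψ1, hψ2⟩
    refine ⟨fun x => φ x + ψ x, (hφ.add hψ).1, (hφ.add hψ).2,
      (Lp.coeFn_add f g).trans (hf.add hg), (Lp.coeFn_add f' g').trans ((hf'.add hg').trans ?_)⟩
    refine Eventually.of_forall fun ξ => ?_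
    simp only [fourierIntegral, add_mul]
    exact (integral_add (integrable_mul_chi hφ.integrable ξ)
      (integrable_mul_chi hψ.integrable ξ)).symm
  smul_mem' := by
    rintro c ⟨f, f'⟩ ⟨φ, hφ1, hφ2, hf, hf'⟩
    have hφ : IsTest φ := ⟨hφ1, hφ2⟩
    refine ⟨fun x => c * φ x, (hφ.const_mul c).1, (hφ.const_mul c).2,
      (Lp.coeFn_smul c f).trans (hf.const_smul c),
      (Lp.coeFn_smul c f').trans ((hf'.const_smul c).trans ?_)⟩
    refine Eventually.of_forall fun ξ => ?_
    simp only [fourierIntegral, mul_assoc]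
    exact (integral_const_mul c _).symm

/-- The graph of the Fourier transform of `L²(ℚ_S)`. -/
def fourierGraph (S : Finset Nat.Primes) : Submodule ℂ (L2 S × L2 S) :=
  (testGraph S).topologicalClosure

instance completeSpace_fourierGraph : CompleteSpace (fourierGraph S) :=
  inferInstanceAs (CompleteSpace (testGraph S).topologicalClosure)

/-- The extension principle behind Plancherel, the multiplication formula and inversion on `L²`: a
closed relation has to be checked on test functions only. -/
theorem HasFourier.mem_of_isClosed {f g : L2 S} (h : HasFourier f g) {C : Set (L2 S × L2 S)}
    (hC : IsClosed C) (hsub : ∀ (f g : L2 S) (φ : QS S → ℂ), IsTest φ → f =ᵐ[haar S] φ →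
      g =ᵐ[haar S] fourierIntegral φ → (f, g) ∈ C) : (f, g) ∈ C := by
  have := closure_minimal (s := {q : L2 S × L2 S | ∃ φ : QS S → ℂ, IsLocallyConstant φ ∧
    HasCompactSupport φ ∧ q.1 =ᵐ[haar S] φ ∧ q.2 =ᵐ[haar S] fourierIntegral φ}) (t := C)
    (by rintro ⟨f, g⟩ ⟨φ, h1, h2, hf, hg⟩; exact hsub f g φ ⟨h1, h2⟩ hf hg) hC
  exact this h

theorem norm_eq_of_hasFourier {f g : L2 S} (h : HasFourier f g) : ‖f‖ = ‖g‖ := by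
  refine h.mem_of_isClosed (C := {q : L2 S × L2 S | ‖q.1‖ = ‖q.2‖})
    (isClosed_eq continuous_fst.norm continuous_snd.norm) fun f g φ hφ hf hg => ?_
  change ‖f‖ = ‖g‖
  have h1 := norm_sq_eq_integral hf
  rw [← hφ.integral_fourierIntegral_mul_conj, ← norm_sq_eq_integral hg] at h1
  have h2 : ‖f‖ ^ 2 = ‖g‖ ^ 2 := by exact_mod_cast h1
  exact (pow_left_inj₀ (norm_nonneg _) (norm_nonneg _) two_ne_zero).1 h2

/-- The isometric first projection of the graph of the Fourier transform. -/
def graphFst (S : Finset Nat.Primes) : fourierGraph S →ₗᵢ[ℂ] L2 S where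
  toLinearMap := (LinearMap.fst ℂ (L2 S) (L2 S)).comp (fourierGraph S).subtype
  norm_map' := by
    rintro ⟨⟨f, g⟩, h⟩
    change ‖f‖ = max ‖f‖ ‖g‖
    rw [← norm_eq_of_hasFourier h, max_self]

/-- The isometric second projection of the graph of the Fourier transform. -/
def graphSnd (S : Finset Nat.Primes) : fourierGraph S →ₗᵢ[ℂ] L2 S where
  toLinearMap := (LinearMap.snd ℂ (L2 S) (L2 S)).comp (fourierGraph S).subtype
  norm_map' := by
    rintro ⟨⟨f, g⟩, h⟩
    change ‖g‖ = max ‖f‖ ‖g‖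
    rw [← norm_eq_of_hasFourier h, max_self]

theorem hasFourier_of_isTest {φ : QS S → ℂ} (h : IsTest φ) :
    HasFourier (h.memLp.toLp φ) (h.fourierIntegral.memLp.toLp _) :=
  subset_closure ⟨φ, h.1, h.2, h.memLp.coeFn_toLp, h.fourierIntegral.memLp.coeFn_toLp⟩

/-- An isometry from a complete space has closed range, and this range contains the dense set of
test functions. -/
theorem surjective_of_isTest_mem_range (i : fourierGraph S →ₗᵢ[ℂ] L2 S)
    (h : ∀ φ (hφ : IsTest φ), hφ.memLp.toLp φ ∈ Set.range i) : Function.Surjective i := by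
  rw [← Set.range_eq_univ, ← i.isometry.isClosedEmbedding.isClosed_range.closure_eq]
  refine (dense_isTest.mono ?_).closure_eq
  rintro f ⟨φ, hφ, hf⟩
  have : f = hφ.memLp.toLp φ := Lp.ext (hf.trans hφ.memLp.coeFn_toLp.symm)
  rw [this]
  exact h φ hφ

theorem surjective_graphFst : Function.Surjective (graphFst S) :=
  surjective_of_isTest_mem_range _ fun _ hφ => ⟨⟨_, hasFourier_of_isTest hφ⟩, rfl⟩

theorem surjective_graphSnd : Function.Surjective (graphSnd S) := by
  refine surjective_of_isTest_mem_range _ fun ψ hψ => ?_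
  obtain ⟨φ, hφ, rfl⟩ := hψ.exists_fourierIntegral_eq
  exact ⟨⟨_, hasFourier_of_isTest hφ⟩, rfl⟩

/-- The Fourier transform of `L²(ℚ_S)` as a unitary operator. -/
def fourierL2 (S : Finset Nat.Primes) : L2 S ≃ₗᵢ[ℂ] L2 S :=
  (LinearIsometryEquiv.ofSurjective (graphFst S) surjective_graphFst).symm.trans
    (LinearIsometryEquiv.ofSurjective (graphSnd S) surjective_graphSnd)

theorem hasFourier_iff {f g : L2 S} : HasFourier f g ↔ fourierL2 S f = g := by
  constructor
  · intro h
    have h1 : (LinearIsometryEquiv.ofSurjective (graphFst S) surjective_graphFst).symm f =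
        ⟨(f, g), h⟩ := by
      rw [LinearIsometryEquiv.symm_apply_eq]; rfl
    rw [fourierL2, LinearIsometryEquiv.trans_apply, h1]; rfl
  · rintro rfl
    obtain ⟨⟨⟨f', g⟩, h⟩, rfl⟩ :=
      (LinearIsometryEquiv.ofSurjective (graphFst S) surjective_graphFst).surjective f
    rw [fourierL2, LinearIsometryEquiv.trans_apply, LinearIsometryEquiv.symm_apply_apply]
    exact h

theorem HasFourier.integral_mul {f g : L2 S} (h : HasFourier f g) {ψ : QS S → ℂ}
    (hψ : IsTest ψ) :
    ∫ ξ, g ξ * ψ ξ ∂(haar S) = ∫ x, f x * fourierIntegral ψ x ∂(haar S) := by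
  refine h.mem_of_isClosed (C := {q : L2 S × L2 S | ∫ ξ, q.2 ξ * ψ ξ ∂(haar S) =
    ∫ x, q.1 x * fourierIntegral ψ x ∂(haar S)}) (isClosed_eq
      ((continuous_integral_mul hψ.memLp).comp continuous_snd)
      ((continuous_integral_mul hψ.fourierIntegral.memLp).comp continuous_fst))
    fun f g φ hφ hf hg => ?_
  have h1 := integral_fourierIntegral_mul hφ.integrable hψ.integrable
  refine Eq.trans (integral_congr_ae ?_) (h1.trans (integral_congr_ae ?_))
  · filter_upwards [hg] with x hx
    rw [hx]
  · filter_upwards [hf] with x hx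
    rw [hx]

theorem continuous_fourierIntegral {g : QS S → ℂ} (hg : Integrable g (haar S)) :
    Continuous (fourierIntegral g) := by
  refine continuous_of_dominated (bound := fun x => ‖g x‖)
    (fun ξ => (integrable_mul_chi hg ξ).1) (fun ξ => Eventually.of_forall fun x => ?_) hg.norm
    (Eventually.of_forall fun x => ?_)
  · rw [norm_mul, norm_chi, mul_one]
  · exact continuous_const.mul (continuous_chi.comp (continuous_id.mul continuous_const))

theorem norm_fourierIntegral_le (g : QS S → ℂ) (ξ : QS S) :
    ‖fourierIntegral g ξ‖ ≤ ∫ x, ‖g x‖ ∂(haar S) := by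
  refine (norm_integral_le_integral_norm _).trans (le_of_eq ?_)
  simp only [norm_mul, norm_chi, mul_one]

/-- On `L¹ ∩ L²` the Fourier transform is given by the integral. -/
theorem HasFourier.ae_eq_fourierIntegral {f g : L2 S} (h : HasFourier f g)
    (hf : Integrable f (haar S)) : g =ᵐ[haar S] fourierIntegral f := by
  have hcont := continuous_fourierIntegral hf
  -- The integral transform is bounded and continuous but not yet known to be in `L²`. Cut off to a
  -- compact set, the difference is in `L²` and can be tested against `ψ`; countably many such sets
  -- exhaust `ℚ_S`.
  have key : ∀ n : ℕ, ∀ᵐ ξ ∂(haar S), ξ ∈ filt S (-n) → g ξ = fourierIntegral f ξ := by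
    intro n
    have : IsFiniteMeasure ((haar S).restrict (filt S (-n))) :=
      ⟨by rw [Measure.restrict_apply_univ]; exact haar_filt_lt_top _⟩
    have hmem : MemLp ((filt S (-n)).indicator fun ξ => g ξ - fourierIntegral f ξ) 2 (haar S) := by
      rw [memLp_indicator_iff_restrict (measurableSet_filt _)]
      exact ((Lp.memLp g).restrict _).sub (MemLp.of_bound hcont.aestronglyMeasurable _
        (Eventually.of_forall (norm_fourierIntegral_le _)))
    have h0 := ae_eq_zero_of_forall_isTest hmem fun ψ hψ => by
      have hψn := (isTest_filtIndicator (S := S) (-n)).mul hψ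
      have h1 := h.integral_mul hψn
      have h2 := integral_fourierIntegral_mul hf hψn.integrable
      rw [← h2, ← sub_eq_zero, ← integral_sub] at h1
      · rw [← h1]
        refine integral_congr_ae (Eventually.of_forall fun ξ => ?_)
        by_cases hξ : ξ ∈ filt S (-n)
        · simp only [Set.indicator_of_mem hξ, filtIndicator_of_mem hξ]; ring
        · simp only [Set.indicator_of_notMem hξ, filtIndicator_of_notMem hξ]; ring
      · exact (Lp.memLp g).integrable_mul hψn.memLp
      · exact hψn.integrable.bdd_mul hcont.aestronglyMeasurable
          (Eventually.of_forall (norm_fourierIntegral_le _))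
    filter_upwards [h0] with ξ hξ hmem
    rw [Set.indicator_of_mem hmem] at hξ
    exact sub_eq_zero.1 hξ
  filter_upwards [ae_all_iff.2 key] with ξ hξ
  obtain ⟨n, hn⟩ := exists_subset_filt (isCompact_singleton (x := ξ))
  refine hξ n.natAbs (filt_anti ?_ (hn rfl))
  omega

/-! ### Multiplication semigroups on `L²` -/

section Multiplication

theorem norm_cexp_neg_le_one {X : Type*} {m : X → ℝ} (h0 : ∀ x, 0 ≤ m x) {t : ℝ} (ht : 0 ≤ t)
    (x : X) :
    ‖((Real.exp (-t * m x) : ℝ) : ℂ)‖ ≤ 1 := by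
  rw [Complex.norm_real, Real.norm_of_nonneg (Real.exp_nonneg _), Real.exp_le_one_iff]
  nlinarith [mul_nonneg ht (h0 x)]

variable {X : Type*} [MeasurableSpace X] {μ : Measure X}

/-- Dominated convergence in `L²`. -/
theorem tendsto_L2_of_dominated {ι : Type*} {l : Filter ι} [l.IsCountablyGenerated]
    {F : ι → Lp ℂ 2 μ} {G : Lp ℂ 2 μ} {u : ι → X → ℂ} {b : X → ℝ} (hb : MemLp b 2 μ)
    (hF : ∀ i, F i =ᵐ[μ] u i) (hbound : ∀ᶠ i in l, ∀ᵐ x ∂μ, ‖u i x‖ ≤ b x)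
    (hG : ∀ᵐ x ∂μ, ‖G x‖ ≤ b x)
    (hlim : ∀ᵐ x ∂μ, Tendsto (fun i => u i x) l (𝓝 (G x))) : Tendsto F l (𝓝 G) := by
  rw [Lp.tendsto_Lp_iff_tendsto_eLpNorm']
  have h2 : ∀ i, eLpNorm ((F i : X → ℂ) - (G : X → ℂ)) 2 μ =
      (∫⁻ x, ‖u i x - G x‖ₑ ^ (2 : ℝ) ∂μ) ^ (1 / 2 : ℝ) := by
    intro i
    rw [eLpNorm_eq_lintegral_rpow_enorm_toReal two_ne_zero ENNReal.ofNat_ne_top]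
    simp only [ENNReal.toReal_ofNat]
    congr 1
    refine lintegral_congr_ae ?_
    filter_upwards [hF i] with x hx
    rw [Pi.sub_apply, hx]
  simp only [h2]
  have h3 : Tendsto (fun i => ∫⁻ x, ‖u i x - G x‖ₑ ^ (2 : ℝ) ∂μ) l (𝓝 (∫⁻ _, 0 ∂μ)) := by
    refine tendsto_lintegral_filter_of_dominated_convergence'
      (fun x => ‖2 * b x‖ₑ ^ (2 : ℝ)) (Eventually.of_forall fun i => ?_) ?_ ?_ ?_
    · exact ((((Lp.aestronglyMeasurable (F i)).congr (hF i)).sub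
        (Lp.aestronglyMeasurable G)).enorm.pow_const _)
    · filter_upwards [hbound] with i hi
      filter_upwards [hi, hG] with x hx1 hx2
      gcongr
      rw [enorm_le_iff_norm_le]
      refine (norm_sub_le _ _).trans ((add_le_add hx1 hx2).trans ?_)
      rw [← two_mul]; exact le_abs_self _
    · have := (hb.const_mul 2).2
      rw [eLpNorm_lt_top_iff_lintegral_rpow_enorm_lt_top two_ne_zero ENNReal.ofNat_ne_top] at this
      simpa using this.ne
    · filter_upwards [hlim] with x hx
      have h4 : Tendsto (fun i => ‖u i x - G x‖ₑ) l (𝓝 0) := by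
        have := (hx.sub_const (G x)).enorm
        simpa using this
      have := (ENNReal.continuous_rpow_const (y := 2)).tendsto 0 |>.comp h4
      simpa [Function.comp_def] using this
  have := (ENNReal.continuous_rpow_const (y := 1 / 2)).tendsto _ |>.comp h3
  simpa [Function.comp_def] using this

theorem memLp_mul_of_norm_le_one {k : X → ℂ} (hk : Measurable k) (hb : ∀ x, ‖k x‖ ≤ 1)
    {f : X → ℂ} (hf : MemLp f 2 μ) : MemLp (fun x => k x * f x) 2 μ :=
  hf.of_le (hk.aestronglyMeasurable.mul hf.1) (Eventually.of_forall fun x => by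
    rw [norm_mul]; exact mul_le_of_le_one_left (norm_nonneg _) (hb x))

/-- Multiplication by a measurable function bounded by one. -/
def mulOp (μ : Measure X) (k : X → ℂ) (hk : Measurable k) (hb : ∀ x, ‖k x‖ ≤ 1) :
    Lp ℂ 2 μ →L[ℂ] Lp ℂ 2 μ :=
  LinearMap.mkContinuous
    { toFun := fun f => (memLp_mul_of_norm_le_one hk hb (Lp.memLp f)).toLp _
      map_add' := fun f g => by
        rw [← MemLp.toLp_add]
        apply MemLp.toLp_congr
        filter_upwards [Lp.coeFn_add f g] with x hx
        rw [hx]; simp only [Pi.add_apply]; ring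
      map_smul' := fun c f => by
        rw [RingHom.id_apply, ← MemLp.toLp_const_smul]
        apply MemLp.toLp_congr
        filter_upwards [Lp.coeFn_smul c f] with x hx
        rw [hx]; simp only [Pi.smul_apply, smul_eq_mul]; ring } 1 fun f => by
    rw [one_mul]
    refine Lp.norm_le_norm_of_ae_le ?_
    filter_upwards [(memLp_mul_of_norm_le_one hk hb (Lp.memLp f)).coeFn_toLp] with x hx
    refine (congrArg norm hx).trans_le ?_
    rw [norm_mul]; exact mul_le_of_le_one_left (norm_nonneg _) (hb x)

theorem coeFn_mulOp {k : X → ℂ} (hk : Measurable k) (hb : ∀ x, ‖k x‖ ≤ 1) (f : Lp ℂ 2 μ) :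
    mulOp μ k hk hb f =ᵐ[μ] fun x => k x * f x :=
  (memLp_mul_of_norm_le_one hk hb (Lp.memLp f)).coeFn_toLp

variable {m : X → ℝ}

theorem measurable_cexp_neg (hm : Measurable m) (t : ℝ) :
    Measurable fun x => ((Real.exp (-t * m x) : ℝ) : ℂ) :=
  Complex.measurable_ofReal.comp (Real.measurable_exp.comp (hm.const_mul _))

/-- The multiplication semigroup `exp (-t m)`. -/
def expOp (μ : Measure X) (hm : Measurable m) (h0 : ∀ x, 0 ≤ m x) (t : ℝ≥0) :
    Lp ℂ 2 μ →L[ℂ] Lp ℂ 2 μ :=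
  mulOp μ _ (measurable_cexp_neg hm t) (norm_cexp_neg_le_one h0 t.2)

variable (hm : Measurable m) (h0 : ∀ x, 0 ≤ m x)

theorem coeFn_expOp (t : ℝ≥0) (f : Lp ℂ 2 μ) :
    expOp μ hm h0 t f =ᵐ[μ] fun x => ((Real.exp (-t * m x) : ℝ) : ℂ) * f x := coeFn_mulOp _ _ _

theorem expOp_zero : expOp μ hm h0 0 = ContinuousLinearMap.id ℂ _ := by
  ext1 f
  refine Lp.ext ?_
  filter_upwards [coeFn_expOp hm h0 0 f] with x hx
  rw [hx]; simp

theorem expOp_add (s t : ℝ≥0) :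
    expOp μ hm h0 (s + t) = (expOp μ hm h0 s).comp (expOp μ hm h0 t) := by
  ext1 f
  refine Lp.ext ?_
  filter_upwards [coeFn_expOp hm h0 (s + t) f, coeFn_expOp hm h0 t f,
    coeFn_expOp hm h0 s (expOp μ hm h0 t f)] with x h1 h2 h3
  rw [h1, ContinuousLinearMap.comp_apply, h3, h2, ← mul_assoc, ← Complex.ofReal_mul,
    ← Real.exp_add]
  push_cast
  ring_nf

theorem continuous_expOp_apply (f : Lp ℂ 2 μ) : Continuous fun t => expOp μ hm h0 t f := by
  rw [continuous_iff_continuousAt]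
  intro t
  refine tendsto_L2_of_dominated (Lp.memLp f).norm (fun s => coeFn_expOp hm h0 s f)
    (Eventually.of_forall fun s => Eventually.of_forall fun x => ?_) ?_ ?_
  · rw [norm_mul]
    exact mul_le_of_le_one_left (norm_nonneg _) (norm_cexp_neg_le_one h0 s.2 x)
  · filter_upwards [coeFn_expOp hm h0 t f] with x hx
    rw [hx, norm_mul]
    exact mul_le_of_le_one_left (norm_nonneg _) (norm_cexp_neg_le_one h0 t.2 x)
  · filter_upwards [coeFn_expOp hm h0 t f] with x hx
    rw [hx]
    exact Continuous.tendsto (f := fun s : ℝ≥0 => ((Real.exp (-s * m x) : ℝ) : ℂ) * f x)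
      (by fun_prop) t

/-- With `a = s m`, `b = t m` this bounds difference quotients of the symbol by `m`, uniformly in
`s` and `t`. -/
theorem abs_exp_neg_sub_exp_neg_le {a b : ℝ} (ha : 0 ≤ a) (hb : 0 ≤ b) :
    |Real.exp (-a) - Real.exp (-b)| ≤ |a - b| := by
  wlog hab : a ≤ b generalizing a b
  · rw [abs_sub_comm, abs_sub_comm a]; exact this hb ha (le_of_not_ge hab)
  rw [abs_of_nonneg (sub_nonneg.2 (Real.exp_le_exp.2 (by linarith))), abs_sub_comm,
    abs_of_nonneg (sub_nonneg.2 hab)]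
  have h1 : Real.exp (-b) = Real.exp (-a) * Real.exp (-(b - a)) := by
    rw [← Real.exp_add]; ring_nf
  have h2 := Real.one_sub_le_exp_neg (b - a)
  have h3 : Real.exp (-a) ≤ 1 := by rw [Real.exp_le_one_iff]; linarith
  have h4 := Real.exp_pos (-a)
  rw [h1]
  nlinarith

theorem hasDerivWithinAt_exp_neg_mul (c : ℝ) (z : ℂ) (t : ℝ) (ht : 0 ≤ t) :
    HasDerivWithinAt (fun s : ℝ => ((Real.exp (-s.toNNReal * c) : ℝ) : ℂ) * z)
      (-(((Real.exp (-t * c) : ℝ) : ℂ) * ((c : ℂ) * z))) (Set.Ici 0) t := by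
  have h1 : HasDerivAt (fun s : ℝ => Real.exp (-s * c)) (Real.exp (-t * c) * (-1 * c)) t :=
    (((hasDerivAt_id t).neg).mul_const c).exp
  have h2 : HasDerivAt (fun s : ℝ => ((Real.exp (-s * c) : ℝ) : ℂ) * z)
      (((Real.exp (-t * c) * (-1 * c) : ℝ) : ℂ) * z) t := h1.ofReal_comp.mul_const z
  refine ((h2.hasDerivWithinAt (s := Set.Ici 0)).congr (fun s hs => ?_) ?_).congr_deriv ?_
  · rw [Real.coe_toNNReal s hs]
  · rw [Real.coe_toNNReal t ht]
  · push_cast; ring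

/-- Dominated convergence of the slopes, with majorant `|g| = m |f|`. -/
theorem hasDerivWithinAt_expOp {f g : Lp ℂ 2 μ} (hg : g =ᵐ[μ] fun x => (m x : ℂ) * f x)
    {t : ℝ} (ht : 0 ≤ t) :
    HasDerivWithinAt (fun s : ℝ => expOp μ hm h0 s.toNNReal f) (-(expOp μ hm h0 t.toNNReal g))
      (Set.Ici 0) t := by
  have hG : (-(expOp μ hm h0 t.toNNReal g) : Lp ℂ 2 μ) =ᵐ[μ]
      fun x => -(((Real.exp (-t * m x) : ℝ) : ℂ) * ((m x : ℂ) * f x)) := by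
    filter_upwards [Lp.coeFn_neg (expOp μ hm h0 t.toNNReal g), coeFn_expOp hm h0 t.toNNReal g, hg]
      with x h1 h2 h3
    rw [h1, Pi.neg_apply, h2, h3, Real.coe_toNNReal t ht]
  rw [hasDerivWithinAt_iff_tendsto_slope]
  refine tendsto_L2_of_dominated (b := fun x => ‖g x‖)
    (u := fun s x => slope (fun s : ℝ => ((Real.exp (-s.toNNReal * m x) : ℝ) : ℂ) * f x) t s)
    (Lp.memLp g).norm (fun s => ?_) ?_ ?_ ?_
  · filter_upwards [Lp.coeFn_smul ((s - t)⁻¹) (expOp μ hm h0 s.toNNReal f -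
      expOp μ hm h0 t.toNNReal f), Lp.coeFn_sub (expOp μ hm h0 s.toNNReal f)
      (expOp μ hm h0 t.toNNReal f), coeFn_expOp hm h0 s.toNNReal f,
      coeFn_expOp hm h0 t.toNNReal f] with x h1 h2 h3 h4
    rw [slope_def_module, slope_def_module, h1, Pi.smul_apply, h2, Pi.sub_apply, h3, h4]
  · refine Eventually.of_forall fun s => ?_
    filter_upwards [hg] with x hx
    rw [slope_def_module, ← sub_mul, ← Complex.ofReal_sub, norm_smul, norm_mul, hx, norm_mul,
      ← mul_assoc, norm_inv, Complex.norm_real, Complex.norm_real, Real.norm_eq_abs,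
      Real.norm_eq_abs, Real.norm_eq_abs, abs_of_nonneg (h0 x)]
    gcongr
    have h1 := abs_exp_neg_sub_exp_neg_le (mul_nonneg s.toNNReal.2 (h0 x))
      (mul_nonneg t.toNNReal.2 (h0 x))
    rw [neg_mul, neg_mul]
    by_cases hst : s = t
    · subst hst; simpa using h0 x
    rw [inv_mul_le_iff₀ (abs_pos.2 (sub_ne_zero.2 hst))]
    refine h1.trans ?_
    rw [← sub_mul, abs_mul, abs_of_nonneg (h0 x)]
    exact mul_le_mul_of_nonneg_right (abs_max_sub_max_le_abs s t 0) (h0 x)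
  · filter_upwards [hG, hg] with x hx hx2
    rw [hx, norm_neg, norm_mul, ← hx2]
    exact mul_le_of_le_one_left (norm_nonneg _) (norm_cexp_neg_le_one h0 ht x)
  · filter_upwards [hG] with x hx
    rw [hx]
    exact (hasDerivWithinAt_iff_tendsto_slope.1 (hasDerivWithinAt_exp_neg_mul (m x) (f x) t ht))

theorem tendsto_coe_nhdsGT_zero :
    Tendsto (fun h : ℝ≥0 => (h : ℝ)) (𝓝[>] 0) (𝓝[Set.Ici 0 \ {0}] 0) := by
  refine tendsto_nhdsWithin_iff.2 ⟨?_, ?_⟩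
  · exact (NNReal.continuous_coe.tendsto 0).mono_left nhdsWithin_le_nhds
  · filter_upwards [self_mem_nhdsWithin] with h hh
    exact ⟨h.2, by simpa using (ne_of_gt hh)⟩

/-- If the quotients converge in `L²`, a subsequence along `h = 1 / (n + 1)` converges almost
everywhere, and its limit must be the pointwise derivative `-m f`. Hence the domain is exactly the
maximal one. The converse is the derivative at `t = 0`. -/
theorem isGenerator_expOp_iff {f g : Lp ℂ 2 μ} :
    IsGenerator (expOp μ hm h0) f g ↔ g =ᵐ[μ] fun x => -((m x : ℂ) * f x) := by
  constructor
  · intro h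
    have hseq : Tendsto (fun n : ℕ => (1 / ((n : ℝ≥0) + 1) : ℝ≥0)) atTop (𝓝[>] 0) :=
      tendsto_nhdsWithin_iff.2 ⟨tendsto_one_div_add_atTop_nhds_zero_nat,
        Eventually.of_forall fun n => by simp⟩
    obtain ⟨ns, hns, hae⟩ := (tendstoInMeasure_of_tendsto_Lp (h.comp hseq)).exists_seq_tendsto_ae
    have hcoe : ∀ᵐ x ∂μ, ∀ n : ℕ, ((fun h : ℝ≥0 => (((h : ℝ)⁻¹ : ℝ) : ℂ) •
        (expOp μ hm h0 h f - f)) (1 / ((n : ℝ≥0) + 1)) : Lp ℂ 2 μ) x =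
        slope (fun s : ℝ => ((Real.exp (-s.toNNReal * m x) : ℝ) : ℂ) * f x) 0
          ((1 / ((n : ℝ≥0) + 1) : ℝ≥0) : ℝ) := by
      refine ae_all_iff.2 fun n => ?_
      set k : ℝ≥0 := 1 / ((n : ℝ≥0) + 1)
      filter_upwards [Lp.coeFn_smul ((((k : ℝ)⁻¹ : ℝ) : ℂ)) (expOp μ hm h0 k f - f),
        Lp.coeFn_sub (expOp μ hm h0 k f) f, coeFn_expOp hm h0 k f] with x h1 h2 h3
      rw [h1, Pi.smul_apply, h2, Pi.sub_apply, h3, slope_def_module]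
      simp
    filter_upwards [hae, hcoe] with x h1 h2
    have h3 := (hasDerivWithinAt_iff_tendsto_slope.1
      (hasDerivWithinAt_exp_neg_mul (m x) (f x) 0 le_rfl)).comp
        (tendsto_coe_nhdsGT_zero.comp (hseq.comp hns.tendsto_atTop))
    have h4 := tendsto_nhds_unique h1 (h3.congr fun n => (h2 (ns n)).symm)
    rw [h4]; simp
  · intro hg
    have hg' : (-g : Lp ℂ 2 μ) =ᵐ[μ] fun x => (m x : ℂ) * f x := by
      filter_upwards [hg, Lp.coeFn_neg g] with x h1 h2
      rw [h2, Pi.neg_apply, h1, neg_neg]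
    have h1 := (hasDerivWithinAt_iff_tendsto_slope.1
      (hasDerivWithinAt_expOp hm h0 hg' le_rfl)).comp tendsto_coe_nhdsGT_zero
    rw [Real.toNNReal_zero, expOp_zero, ContinuousLinearMap.id_apply, neg_neg] at h1
    refine h1.congr fun k => ?_
    rw [Function.comp_apply, slope_def_module, Real.toNNReal_zero, expOp_zero,
      ContinuousLinearMap.id_apply, Real.toNNReal_coe, sub_zero]
    exact (Complex.coe_smul _ _).symm

theorem memLp_mul_expOp {t : ℝ≥0} (ht : 0 < t) (f : Lp ℂ 2 μ) :
    MemLp (fun x => (m x : ℂ) * expOp μ hm h0 t f x) 2 μ := by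
  have ht' : (0 : ℝ) < t := ht
  refine ((Lp.memLp f).norm.const_mul (t : ℝ)⁻¹).of_le
    ((Complex.measurable_ofReal.comp hm).aestronglyMeasurable.mul (Lp.aestronglyMeasurable _)) ?_
  filter_upwards [coeFn_expOp hm h0 t f] with x hx
  rw [hx, norm_mul, norm_mul, ← mul_assoc, norm_mul, norm_norm, Complex.norm_real,
    Complex.norm_real, Real.norm_of_nonneg (h0 x), Real.norm_of_nonneg (Real.exp_nonneg _),
    Real.norm_of_nonneg (by positivity)]
  gcongr
  -- This is the smoothing bound `m exp(-t m) ≤ 1 / t`, from `t m + 1 ≤ exp(t m)`.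
  rw [neg_mul, Real.exp_neg, mul_inv_le_iff₀ (Real.exp_pos _), le_inv_mul_iff₀ ht']
  linarith [Real.add_one_le_exp ((t : ℝ) * m x)]

end Multiplication

/-! ### Uniqueness for dissipative evolution equations -/

section Uniqueness

variable {E : Type*} [NormedAddCommGroup E] [InnerProductSpace ℂ E] [NormedSpace ℝ E]

/-- The right derivative of `‖w‖²` is `2 Re ⟨w, w'⟩ ≤ 0`, so `‖w‖²` does not increase. The equation
is available only for `t > 0`; the comparison therefore starts at `a > 0`, and continuity at zero
lets `a → 0`. -/
theorem eq_zero_of_dissipative {w : ℝ → E} (hc : ContinuousOn w (Set.Ici 0)) (hw : w 0 = 0)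
    (h : ∀ t, 0 < t → ∃ w', HasDerivWithinAt w w' (Set.Ici t) t ∧ (inner ℂ (w t) w').re ≤ 0)
    {t : ℝ} (ht : 0 ≤ t) : w t = 0 := by
  choose! w' hw' hre using h
  have hsq : ∀ s, ‖w s‖ ^ 2 = (inner ℂ (w s) (w s)).re := fun s => by
    rw [inner_self_eq_norm_sq_to_K]; norm_cast
  have hd : ∀ s, 0 < s → HasDerivWithinAt (fun s => ‖w s‖ ^ 2)
      (2 * (inner ℂ (w s) (w' s)).re) (Set.Ici s) s := by
    intro s hs
    simp only [hsq]
    have h1 := (hw' s hs).inner ℂ (hw' s hs)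
    have h2 := Complex.reCLM.hasFDerivAt.comp_hasDerivWithinAt s h1
    refine HasDerivWithinAt.congr_deriv (f := fun s => (inner ℂ (w s) (w s)).re) h2 ?_
    rw [Complex.reCLM_apply, Complex.add_re, ← inner_conj_symm (w' s), Complex.conj_re]
    ring
  have hle : ∀ a, 0 < a → a ≤ t → ‖w t‖ ^ 2 ≤ ‖w a‖ ^ 2 := by
    intro a ha hat
    refine image_le_of_deriv_right_le_deriv_boundary (f := fun s => ‖w s‖ ^ 2) (a := a) (b := t)
      (B := fun _ => ‖w a‖ ^ 2) (B' := fun _ => 0) (f' := fun s => 2 * (inner ℂ (w s) (w' s)).re)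
      ?_ (fun s hs => hd s (ha.trans_le hs.1)) le_rfl continuousOn_const
      (fun s _ => hasDerivWithinAt_const _ _ _) (fun s hs => ?_) ⟨hat, le_rfl⟩
    · exact ((hc.mono fun s hs => ha.le.trans hs.1).norm).pow 2
    · linarith [hre s (ha.trans_le hs.1)]
  rcases ht.eq_or_lt with rfl | ht
  · exact hw
  have hlim : Tendsto (fun a => ‖w a‖ ^ 2) (𝓝[>] 0) (𝓝 (‖w 0‖ ^ 2)) :=
    (((hc 0 Set.self_mem_Ici).mono Set.Ioi_subset_Ici_self).norm).pow 2
  have h1 : ‖w t‖ ^ 2 ≤ ‖w 0‖ ^ 2 := by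
    refine ge_of_tendsto hlim ?_
    filter_upwards [Ioc_mem_nhdsGT ht] with a ha
    exact hle a ha.1 ha.2
  rw [hw, norm_zero] at h1
  have h2 : ‖w t‖ = 0 := by nlinarith [norm_nonneg (w t)]
  exact norm_eq_zero.1 h2

end Uniqueness

/-! ### Orbits of a general `C₀`-semigroup -/

section Semigroup

variable {E : Type*} [NormedAddCommGroup E] [NormedSpace ℂ E] {R : ℝ≥0 → E →L[ℂ] E}

theorem IsGenerator.apply (hR : IsC0Semigroup R) {f g : E} (h : IsGenerator R f g) (t : ℝ≥0) :
    IsGenerator R (R t f) (R t g) := by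
  refine (((R t).continuous.tendsto g).comp h).congr fun k => ?_
  rw [Function.comp_apply, map_smul, map_sub, ← ContinuousLinearMap.comp_apply,
    ← ContinuousLinearMap.comp_apply, ← hR.add, ← hR.add, add_comm]

/-- For `s > t` the quotient at `t` is the generator quotient of `R t f` with `h = s - t`. Only the
right derivative is obtained, which suffices for `eq_zero_of_dissipative`. -/
theorem IsGenerator.hasDerivWithinAt [NormedSpace ℝ E] [IsScalarTower ℝ ℂ E]
    (hR : IsC0Semigroup R) {f g : E} (h : IsGenerator R f g)
    {t : ℝ} (ht : 0 ≤ t) :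
    HasDerivWithinAt (fun s : ℝ => R s.toNNReal f) (R t.toNNReal g) (Set.Ici t) t := by
  rw [← hasDerivWithinAt_Ioi_iff_Ici, hasDerivWithinAt_iff_tendsto_slope' (by simp)]
  have h1 : Tendsto (fun s : ℝ => (s - t).toNNReal) (𝓝[>] t) (𝓝[>] 0) := by
    refine tendsto_nhdsWithin_iff.2 ⟨?_, ?_⟩
    · have : Continuous fun s : ℝ => (s - t).toNNReal := by fun_prop
      have := (this.tendsto t).mono_left (nhdsWithin_le_nhds (s := Set.Ioi t))
      simpa using this
    · filter_upwards [self_mem_nhdsWithin] with s hs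
      exact Real.toNNReal_pos.2 (sub_pos.2 hs)
  refine ((h.apply hR t.toNNReal).comp h1).congr' ?_
  filter_upwards [self_mem_nhdsWithin] with s hs
  have hs' : t < s := hs
  rw [Function.comp_apply, slope_def_module, ← ContinuousLinearMap.comp_apply, ← hR.add,
    ← Real.toNNReal_add (by linarith) ht, sub_add_cancel,
    Real.coe_toNNReal _ (by linarith : 0 ≤ s - t)]
  rw [← Complex.coe_algebraMap, algebraMap_smul]

end Semigroup

/-! ### The semigroup generated by `-D ^ α` -/

theorem isD_iff {α : ℝ} {f g : L2 S} : IsD α f g ↔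
    fourierL2 S g =ᵐ[haar S] fun ξ => ((normS ξ ^ α : ℝ) : ℂ) * fourierL2 S f ξ := by
  constructor
  · rintro ⟨f', g', hf, hg, h⟩
    rw [hasFourier_iff] at hf hg
    rwa [hf, hg]
  · exact fun h => ⟨_, _, hasFourier_iff.2 rfl, hasFourier_iff.2 rfl, h⟩

theorem mem_domD_iff {α : ℝ} {f : L2 S} : f ∈ domD S α ↔ ∃ g, IsD α f g := by
  constructor
  · rintro ⟨f', hf, h⟩
    rw [hasFourier_iff] at hf
    refine ⟨(fourierL2 S).symm (h.toLp _), isD_iff.2 ?_⟩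
    rw [LinearIsometryEquiv.apply_symm_apply, hf]
    exact h.coeFn_toLp
  · rintro ⟨g, f', g', hf, hg, h⟩
    exact ⟨f', hf, (memLp_congr_ae h).1 (Lp.memLp g')⟩

theorem normS_rpow_nonneg (α : ℝ) (ξ : QS S) : 0 ≤ normS ξ ^ α :=
  Real.rpow_nonneg (normS_nonneg ξ) α

/-- The semigroup `exp (-t D ^ α)`. -/
def heatOp (S : Finset Nat.Primes) (α : ℝ) (t : ℝ≥0) : L2 S →L[ℂ] L2 S :=
  ((fourierL2 S).symm : L2 S →L[ℂ] L2 S).comp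
    ((expOp (haar S) (measurable_normS_rpow α) (normS_rpow_nonneg α) t).comp
      (fourierL2 S : L2 S →L[ℂ] L2 S))

theorem heatOp_apply (α : ℝ) (t : ℝ≥0) (f : L2 S) : heatOp S α t f = (fourierL2 S).symm
    (expOp (haar S) (measurable_normS_rpow α) (normS_rpow_nonneg α) t (fourierL2 S f)) := rfl

theorem fourierL2_heatOp (α : ℝ) (t : ℝ≥0) (f : L2 S) : fourierL2 S (heatOp S α t f) =
    expOp (haar S) (measurable_normS_rpow α) (normS_rpow_nonneg α) t (fourierL2 S f) := by
  rw [heatOp_apply, LinearIsometryEquiv.apply_symm_apply]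

theorem isC0Semigroup_heatOp (α : ℝ) : IsC0Semigroup (heatOp S α) where
  zero := by
    ext1 f
    rw [heatOp_apply, expOp_zero]
    exact (fourierL2 S).symm_apply_apply f
  add s t := by
    ext1 f
    rw [ContinuousLinearMap.comp_apply, heatOp_apply, heatOp_apply, fourierL2_heatOp, expOp_add]
    rfl
  continuous f := (fourierL2 S).symm.continuous.comp (continuous_expOp_apply
    (measurable_normS_rpow α) (normS_rpow_nonneg α) (fourierL2 S f))

theorem isGenerator_heatOp_iff {α : ℝ} {f g : L2 S} :
    IsGenerator (heatOp S α) f g ↔ IsD α f (-g) := by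
  have h1 : IsGenerator (heatOp S α) f g ↔
      IsGenerator (expOp (haar S) (measurable_normS_rpow α) (normS_rpow_nonneg α))
        (fourierL2 S f) (fourierL2 S g) := by
    rw [IsGenerator, (fourierL2 S).isometry.isEmbedding.tendsto_nhds_iff, IsGenerator]
    refine tendsto_congr fun h => ?_
    rw [Function.comp_apply, map_smul, map_sub, fourierL2_heatOp]
  rw [h1, isGenerator_expOp_iff, isD_iff, map_neg]
  constructor
  · intro h
    filter_upwards [h, Lp.coeFn_neg (fourierL2 S g)] with ξ h2 h3
    rw [h3, Pi.neg_apply, h2, neg_neg]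
  · intro h
    filter_upwards [h, Lp.coeFn_neg (fourierL2 S g)] with ξ h2 h3
    rw [h3, Pi.neg_apply] at h2
    rw [← h2, neg_neg]

theorem isC0SemigroupGeneratedByNegD_heatOp (α : ℝ) :
    IsC0SemigroupGeneratedByNegD α (heatOp S α) :=
  ⟨isC0Semigroup_heatOp α, fun _ _ => isGenerator_heatOp_iff⟩

theorem heatOp_mem_domD (α : ℝ) {t : ℝ≥0} (ht : 0 < t) (f : L2 S) :
    heatOp S α t f ∈ domD S α := by
  refine ⟨_, hasFourier_iff.2 rfl, ?_⟩
  rw [fourierL2_heatOp]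
  exact memLp_mul_expOp _ _ ht _

/-- `-D ^ α` is dissipative. -/
theorem re_inner_neg_sub_le_zero {α : ℝ} {f g f' g' : L2 S} (h : IsD α f g) (h' : IsD α f' g') :
    (inner ℂ (f - f') (-g - -g')).re ≤ 0 := by
  rw [isD_iff] at h h'
  -- On the Fourier side the inner product is minus the integral of `‖ξ‖ ^ α` times a squared
  -- modulus.
  rw [← (fourierL2 S).inner_map_map, show -g - -g' = -(g - g') by abel, map_neg, inner_neg_right,
    Complex.neg_re, neg_nonpos, L2.inner_def]
  have h1 : ∀ᵐ ξ ∂(haar S), inner ℂ (fourierL2 S (f - f') ξ) (fourierL2 S (g - g') ξ) =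
      ((normS ξ ^ α * ‖fourierL2 S (f - f') ξ‖ ^ 2 : ℝ) : ℂ) := by
    rw [map_sub, map_sub]
    filter_upwards [h, h', Lp.coeFn_sub (fourierL2 S f) (fourierL2 S f'),
      Lp.coeFn_sub (fourierL2 S g) (fourierL2 S g')] with ξ h1 h2 h3 h4
    rw [h4, h3, Pi.sub_apply, Pi.sub_apply, h1, h2, ← mul_sub, RCLike.inner_apply, mul_assoc,
      Complex.mul_conj, Complex.normSq_eq_norm_sq, Complex.ofReal_mul]
  rw [integral_congr_ae h1, integral_complex_ofReal, Complex.ofReal_re]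
  exact integral_nonneg fun ξ => mul_nonneg (normS_rpow_nonneg α ξ) (sq_nonneg _)

theorem heatOp_toNNReal_zero (α : ℝ) (f : L2 S) : heatOp S α (0 : ℝ).toNNReal f = f := by
  rw [Real.toNNReal_zero, (isC0Semigroup_heatOp α).zero, ContinuousLinearMap.id_apply]

theorem hasDerivWithinAt_heatOp {α : ℝ} {f g : L2 S} (h : IsD α f g) {t : ℝ} (ht : 0 ≤ t) :
    HasDerivWithinAt (fun s : ℝ => heatOp S α s.toNNReal f) (-heatOp S α t.toNNReal g)
      (Set.Ici 0) t := by
  have h1 := hasDerivWithinAt_expOp (measurable_normS_rpow α) (normS_rpow_nonneg α)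
    (isD_iff.1 h) ht
  have h2 := (((fourierL2 S).symm : L2 S →L[ℂ] L2 S).restrictScalars
    ℝ).hasFDerivAt.comp_hasDerivWithinAt t h1
  refine HasDerivWithinAt.congr_deriv h2 ?_
  exact map_neg (fourierL2 S).symm _

theorem continuous_heatOp_toNNReal (α : ℝ) (f : L2 S) :
    Continuous fun s : ℝ => heatOp S α s.toNNReal f :=
  ((isC0Semigroup_heatOp α).continuous f).comp continuous_real_toNNReal

theorem isD_heatOp {α : ℝ} {f g : L2 S} (h : IsD α f g) (t : ℝ≥0) :
    IsD α (heatOp S α t f) (heatOp S α t g) := by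
  have h1 : IsGenerator (heatOp S α) f (-g) := isGenerator_heatOp_iff.2 (by rwa [neg_neg])
  have h2 := isGenerator_heatOp_iff.1 (h1.apply (isC0Semigroup_heatOp α) t)
  rwa [map_neg, neg_neg] at h2

/-- For `f` in the domain both orbits stay in the domain and solve the same dissipative equation
from the right, so they agree. Since `heatOp S α ε f` lies in the domain and tends to `f`,
continuity extends the equality to all `f`. -/
theorem eq_heatOp_of_isC0SemigroupGeneratedByNegD {α : ℝ} {R : ℝ≥0 → L2 S →L[ℂ] L2 S}
    (hR : IsC0SemigroupGeneratedByNegD α R) (t : ℝ≥0) : R t = heatOp S α t := by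
  have key : ∀ f ∈ domD S α, R t f = heatOp S α t f := by
    intro f hf
    obtain ⟨g, hg⟩ := mem_domD_iff.1 hf
    have hgR : IsGenerator R f (-g) := (hR.2 _ _).2 (by rwa [neg_neg])
    have h0 := eq_zero_of_dissipative
      (w := fun s : ℝ => R s.toNNReal f - heatOp S α s.toNNReal f) (t := t)
      (((hR.1.continuous f).comp continuous_real_toNNReal).sub
        (continuous_heatOp_toNNReal α f)).continuousOn
      (by rw [heatOp_toNNReal_zero, Real.toNNReal_zero, hR.1.zero, ContinuousLinearMap.id_apply,
        sub_self])
      (fun s hs => ⟨_, (hgR.hasDerivWithinAt hR.1 hs.le).sub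
        ((hasDerivWithinAt_heatOp hg hs.le).mono
        (Set.Ici_subset_Ici.2 hs.le)), by
        have hD := (hR.2 _ _).1 (hgR.apply hR.1 s.toNNReal)
        have := re_inner_neg_sub_le_zero hD (isD_heatOp hg s.toNNReal)
        rwa [neg_neg] at this⟩) t.2
    rw [Real.toNNReal_coe] at h0
    exact sub_eq_zero.1 h0
  ext1 f
  have hlim : Tendsto (fun ε : ℝ≥0 => heatOp S α ε f) (𝓝[>] 0) (𝓝 f) := by
    have := ((isC0Semigroup_heatOp α).continuous f).tendsto 0
    rw [(isC0Semigroup_heatOp α).zero, ContinuousLinearMap.id_apply] at this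
    exact this.mono_left nhdsWithin_le_nhds
  refine tendsto_nhds_unique (((R t).continuous.tendsto f).comp hlim)
    ((((heatOp S α t).continuous.tendsto f).comp hlim).congr' ?_)
  filter_upwards [self_mem_nhdsWithin] with ε hε
  exact (key _ (heatOp_mem_domD α hε f)).symm

theorem isClassicalSolution_heatOp {α : ℝ} {f : L2 S} (hf : f ∈ domD S α) :
    IsClassicalSolution α f (fun t : ℝ => heatOp S α t.toNNReal f) := by
  obtain ⟨g, hg⟩ := mem_domD_iff.1 hf
  refine ⟨?_, fun t _ => mem_domD_iff.2 ⟨_, isD_heatOp hg _⟩, fun t ht =>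
    ⟨_, isD_heatOp hg _, (hasDerivWithinAt_heatOp hg ht.le).hasDerivAt (Ici_mem_nhds ht)⟩,
    heatOp_toNNReal_zero α f⟩
  rw [contDiffOn_one_iff_derivWithin (uniqueDiffOn_Ici 0)]
  refine ⟨fun t ht => (hasDerivWithinAt_heatOp hg ht).differentiableWithinAt, ?_⟩
  -- The derivative is again an orbit up to sign, hence continuous.
  exact (continuous_heatOp_toNNReal α g).neg.continuousOn.congr fun t ht =>
    (hasDerivWithinAt_heatOp hg ht).derivWithin (uniqueDiffOn_Ici 0 t ht)

theorem IsClassicalSolution.eq_heatOp {α : ℝ} {f : L2 S} (hf : f ∈ domD S α) {u : ℝ → L2 S}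
    (hu : IsClassicalSolution α f u) {t : ℝ} (ht : 0 ≤ t) : u t = heatOp S α t.toNNReal f := by
  obtain ⟨g, hg⟩ := mem_domD_iff.1 hf
  refine sub_eq_zero.1 (eq_zero_of_dissipative
    (w := fun s : ℝ => u s - heatOp S α s.toNNReal f)
    (hu.contDiff.continuousOn.sub (continuous_heatOp_toNNReal α f).continuousOn)
    (by rw [heatOp_toNNReal_zero, hu.initial, sub_self]) (fun s hs => ?_) ht)
  obtain ⟨g', hg', hd⟩ := hu.equation s hs
  exact ⟨_, hd.hasDerivWithinAt.sub ((hasDerivWithinAt_heatOp hg hs.le).mono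
    (Set.Ici_subset_Ici.2 hs.le)), re_inner_neg_sub_le_zero hg' (isD_heatOp hg _)⟩

/-! ### The heat kernel -/

/-- The reflection `x ↦ f (-x)` on `L²(ℚ_S)`. -/
def reflect (S : Finset Nat.Primes) : L2 S →ₗᵢ[ℂ] L2 S :=
  Lp.compMeasurePreservingₗᵢ ℂ (fun x => -x) (Measure.measurePreserving_neg (haar S))

theorem coeFn_reflect (f : L2 S) : reflect S f =ᵐ[haar S] fun x => f (-x) :=
  Lp.coeFn_compMeasurePreserving f (Measure.measurePreserving_neg (haar S))

theorem ae_comp_neg {P : QS S → Prop} (h : ∀ᵐ x ∂(haar S), P x) : ∀ᵐ x ∂(haar S), P (-x) :=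
  (Measure.measurePreserving_neg (haar S)).quasiMeasurePreserving.ae h

theorem fourierL2_fourierL2 (f : L2 S) : fourierL2 S (fourierL2 S f) = reflect S f := by
  refine HasFourier.mem_of_isClosed (hasFourier_iff.2 (rfl : fourierL2 S f = _))
    (C := {q : L2 S × L2 S | fourierL2 S q.2 = reflect S q.1}) (isClosed_eq
      ((fourierL2 S).continuous.comp continuous_snd)
      ((reflect S).continuous.comp continuous_fst)) fun f g φ hφ hf hg => ?_
  change fourierL2 S g = reflect S f
  have hg' : g = hφ.fourierIntegral.memLp.toLp _ :=
    Lp.ext (hg.trans hφ.fourierIntegral.memLp.coeFn_toLp.symm)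
  rw [hg', hasFourier_iff.1 (hasFourier_of_isTest hφ.fourierIntegral)]
  refine Lp.ext (hφ.fourierIntegral.fourierIntegral.memLp.coeFn_toLp.trans ?_)
  filter_upwards [coeFn_reflect f, ae_comp_neg hf] with x h1 h2
  rw [h1, h2, hφ.fourierIntegral_fourierIntegral]

/-- The symbol `exp (-t ‖ξ‖ ^ α)` of the semigroup. -/
def heatSymbol (α t : ℝ) (ξ : QS S) : ℂ := ((Real.exp (-t * normS ξ ^ α) : ℝ) : ℂ)

theorem integrable_heatSymbol {α t : ℝ} (hα : 0 < α) (ht : 0 < t) :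
    Integrable (heatSymbol (S := S) α t) (haar S) := (integrable_exp_neg_normS hα ht).ofReal

theorem memLp_heatSymbol {α t : ℝ} (hα : 0 < α) (ht : 0 < t) :
    MemLp (heatSymbol (S := S) α t) 2 (haar S) := by
  rw [memLp_two_iff_integrable_sq_norm (integrable_heatSymbol hα ht).1]
  refine (integrable_exp_neg_normS hα (mul_pos two_pos ht)).congr
    (Eventually.of_forall fun ξ => ?_)
  simp only [heatSymbol, Complex.norm_real, Real.norm_of_nonneg (Real.exp_nonneg _)]
  rw [← Real.exp_nat_mul]
  congr 1
  push_cast; ring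

theorem heatKernel_eq (α t : ℝ) (x : QS S) :
    heatKernel α t x = fourierIntegral (heatSymbol α t) (-x) := by
  simp only [heatKernel, fourierIntegral, heatSymbol, neg_mul]
  congr 1; ext ξ; rw [mul_comm]

/-- The symbol is in `L¹ ∩ L²`, so its integral transform agrees almost everywhere with its `L²`
transform; the kernel is the reflection of that. -/
theorem memLp_heatKernel {α t : ℝ} (hα : 0 < α) (ht : 0 < t) :
    MemLp (heatKernel (S := S) α t) 2 (haar S) := by
  have hmem := memLp_heatSymbol (S := S) hα ht
  have h1 := HasFourier.ae_eq_fourierIntegral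
    (hasFourier_iff.2 (rfl : fourierL2 S (hmem.toLp _) = _))
    ((integrable_heatSymbol hα ht).congr hmem.coeFn_toLp.symm)
  have h2 : fourierIntegral (hmem.toLp _ : QS S → ℂ) = fourierIntegral (heatSymbol α t) := by
    ext ξ
    refine integral_congr_ae ?_
    filter_upwards [hmem.coeFn_toLp] with x hx
    rw [hx]
  rw [h2] at h1
  have h3 := ((memLp_congr_ae h1).1 (Lp.memLp _)).comp_measurePreserving
    (Measure.measurePreserving_neg (haar S))
  exact (memLp_congr_ae (Eventually.of_forall fun x => heatKernel_eq α t x)).2 h3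

theorem memLp_comp_sub_left {f : QS S → ℂ} (hf : MemLp f 2 (haar S)) (x : QS S) :
    MemLp (fun y => f (x - y)) 2 (haar S) :=
  hf.comp_measurePreserving (Measure.measurePreserving_sub_left (haar S) x)

theorem memLp_heatSymbol_mul_chi {α t : ℝ} (hα : 0 < α) (ht : 0 < t) (x : QS S) :
    MemLp (fun ξ => heatSymbol α t ξ * chi (-(x * ξ))) 2 (haar S) :=
  (memLp_heatSymbol hα ht).of_le ((memLp_heatSymbol hα ht).1.mul (continuous_chi.comp
    (continuous_const.mul continuous_id).neg).aestronglyMeasurable)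
    (Eventually.of_forall fun ξ => by rw [norm_mul, norm_chi, mul_one])

/-- For fixed `x` both sides are continuous in the pair `(f, f̂)`, because the kernel and the
modulated symbol are in `L²`. On test functions this is the multiplication formula, the translate of
the kernel being the transform of the modulated symbol. -/
theorem integral_mul_heatKernel {α t : ℝ} (hα : 0 < α) (ht : 0 < t) (f : L2 S) (x : QS S) :
    ∫ y, f y * heatKernel α t (x - y) ∂(haar S) =
      ∫ ξ, fourierL2 S f ξ * (heatSymbol α t ξ * chi (-(x * ξ))) ∂(haar S) := by
  refine HasFourier.mem_of_isClosed (hasFourier_iff.2 (rfl : fourierL2 S f = _))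
    (C := {q : L2 S × L2 S | ∫ y, q.1 y * heatKernel α t (x - y) ∂(haar S) =
      ∫ ξ, q.2 ξ * (heatSymbol α t ξ * chi (-(x * ξ))) ∂(haar S)}) (isClosed_eq
      ((continuous_integral_mul (memLp_comp_sub_left (memLp_heatKernel hα ht) x)).comp
        continuous_fst)
      ((continuous_integral_mul (memLp_heatSymbol_mul_chi hα ht x)).comp continuous_snd))
      fun f g φ hφ hf hg => ?_
  have hint : Integrable (fun ξ => heatSymbol α t ξ * chi (-(x * ξ))) (haar S) := by
    simpa only [neg_mul] using integrable_mul_chi (integrable_heatSymbol hα ht) (-x)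
  have h1 := integral_fourierIntegral_mul hφ.integrable hint
  refine Eq.trans (integral_congr_ae ?_) (h1.symm.trans (integral_congr_ae ?_))
  · filter_upwards [hf] with y hy
    rw [hy, heatKernel_eq, fourierIntegral, fourierIntegral]
    congr 2; ext ξ
    rw [mul_assoc, ← chi_add]
    congr 2; ring
  · filter_upwards [hg] with ξ hξ
    rw [hξ]

theorem convolutionExists_heatKernel {α t : ℝ} (hα : 0 < α) (ht : 0 < t) (f : L2 S) :
    ConvolutionExists (heatKernel α t) (f : QS S → ℂ) (ContinuousLinearMap.mul ℂ ℂ) (haar S) :=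
  fun x => (memLp_heatKernel hα ht).integrable_mul (memLp_comp_sub_left (Lp.memLp f) x)

theorem heatOp_ae_eq_convolution {α : ℝ} {t : ℝ≥0} (hα : 0 < α) (ht : 0 < t) (f : L2 S) :
    heatOp S α t f =ᵐ[haar S] convolution (heatKernel α t) (f : QS S → ℂ)
      (ContinuousLinearMap.mul ℂ ℂ) (haar S) := by
  have ht' : (0 : ℝ) < t := ht
  have hconv : ∀ x, convolution (heatKernel α t) (f : QS S → ℂ) (ContinuousLinearMap.mul ℂ ℂ)
      (haar S) x = ∫ ξ, fourierL2 S f ξ * (heatSymbol α t ξ * chi (-(x * ξ))) ∂(haar S) := by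
    intro x
    rw [← integral_mul_heatKernel hα ht', convolution_def, ← integral_sub_left_eq_self _ _ x]
    simp only [ContinuousLinearMap.mul_apply', sub_sub_cancel, mul_comm]
  have hG : fourierL2 S (heatOp S α t f) =ᵐ[haar S]
      fun ξ => heatSymbol α t ξ * fourierL2 S f ξ := by
    rw [fourierL2_heatOp]; exact coeFn_expOp _ _ _ _
  -- A product of two `L²` functions is in `L¹`, so the second transform, which is the reflection of
  -- `heatOp S α t f`, is given by the integral.
  have hint : Integrable (fourierL2 S (heatOp S α t f)) (haar S) :=
    ((memLp_heatSymbol hα ht').integrable_mul (Lp.memLp _)).congr hG.symm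
  have h1 := HasFourier.ae_eq_fourierIntegral
    (hasFourier_iff.2 (fourierL2_fourierL2 (heatOp S α t f))) hint
  filter_upwards [ae_comp_neg h1, ae_comp_neg (coeFn_reflect (heatOp S α t f))] with x h2 h3
  rw [hconv, ← neg_neg x, ← h3, neg_neg, h2]
  refine integral_congr_ae ?_
  filter_upwards [hG] with ξ hξ
  rw [hξ, neg_mul]; ring

end SAdic

end

theorem theorem4p1 (S : Finset Nat.Primes) (α : ℝ) (hα : 0 < α) :
    -- the integral defining the heat kernel converges absolutely
    (∀ t : ℝ, 0 < t →
      Integrable (fun ξ : SAdic.QS S => Real.exp (-t * SAdic.normS ξ ^ α)) (SAdic.haar S)) ∧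
    ∃ T : ℝ≥0 → SAdic.L2 S →L[ℂ] SAdic.L2 S,
      -- `T` is given by convolution with the heat kernel
      T 0 = ContinuousLinearMap.id ℂ (SAdic.L2 S) ∧
      (∀ t : ℝ≥0, 0 < t → ∀ f : SAdic.L2 S,
        ConvolutionExists (SAdic.heatKernel α t) (f : SAdic.QS S → ℂ)
          (ContinuousLinearMap.mul ℂ ℂ) (SAdic.haar S) ∧
        (T t f : SAdic.QS S → ℂ) =ᵐ[SAdic.haar S]
          convolution (SAdic.heatKernel α t) (f : SAdic.QS S → ℂ)
            (ContinuousLinearMap.mul ℂ ℂ) (SAdic.haar S)) ∧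
      -- `T` is the `C₀`-semigroup generated by `-D ^ α`
      SAdic.IsC0SemigroupGeneratedByNegD α T ∧
      (∀ R : ℝ≥0 → SAdic.L2 S →L[ℂ] SAdic.L2 S,
        SAdic.IsC0SemigroupGeneratedByNegD α R → ∀ t, R t = T t) ∧
      -- `t ↦ T t f` is the classical solution of the Cauchy problem
      ∀ f ∈ SAdic.domD S α,
        SAdic.IsClassicalSolution α f (fun t : ℝ => T t.toNNReal f) ∧
        ∀ u : ℝ → SAdic.L2 S, SAdic.IsClassicalSolution α f u →
          ∀ t : ℝ, 0 ≤ t → u t = T t.toNNReal f := by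
  refine ⟨fun t ht => SAdic.integrable_exp_neg_normS hα ht, SAdic.heatOp S α,
    (SAdic.isC0Semigroup_heatOp α).zero, fun t ht f =>
      ⟨SAdic.convolutionExists_heatKernel hα ht f, SAdic.heatOp_ae_eq_convolution hα ht f⟩,
    SAdic.isC0SemigroupGeneratedByNegD_heatOp α,
    fun R hR t => SAdic.eq_heatOp_of_isC0SemigroupGeneratedByNegD hR t,
    fun f hf => ⟨SAdic.isClassicalSolution_heatOp hf, fun u hu t ht => hu.eq_heatOp hf ht⟩⟩
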